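/- Let $q>1$ be real and let $\hat f(z)=\sum_{p\ge 1}f_pz^p\in\mathbb{C}[[z]]$. Write $(z\sigma_q)y(z)=z\,y(qz)$, and let $\mathbb{C}\{z\}$ be the set of power series with positive radius of convergence. **Sectors and asymptotics.** Let $\mathcal R$ be the Riemann surface of the logarithm and, for $d\in\mathbb{R}$ and $\theta,r>0$, let $S_d(\theta,r)=\{z\in\mathcal R:\ |\arg z-d|<\pi\theta/2,\ 0<|z|<r\}$ and $S_d(\theta)=S_d(\theta,\infty)$. A holomorphic function $F$ on a sector $S$ has $q$-Gevrey asymptotic expansion $\sum_p c_pz^p$ in $S$ if for every sector $T$ of finite radius with $\overline T\setminus\{0\}\subset S$ there are $C,A>0$ such that $|F(z)-\sum_{p=0}^{N-1}c_pz^p|\le CA^Nq^{N(N-1)/2}|z|^N$ for all $z\in T$ and all integers $N\ge 0$. **Summability.** The series $\hat f$ is $q$-Gevrey summable in direction $d$ if $|f_p|\le CA^pq^{p(p-1)/2}$ for all $p$ and some $C,A>0$, and the sum of its $q$-Borel transform $\sum_p q^{-p(p-1)/2}f_pz^p$ near $0$ extends to a holomorphic function $\Phi$ on some unbounded sector $S_d(\varepsilon)$,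 $\varepsilon>0$, with $|\Phi(z)|\le C'\,|z^{\mu}e^{(\log z)^2/(2\ln q)}|$ there, for some $C'>0$ and $\mu\in\mathbb{R}$. A $q$-Gevrey sum of $\hat f$ in direction $d$ on a sector $S_d(\theta,R)$ is then a function $f$, holomorphic on $S_d(\theta,R)$, given at the points with $|\arg z-d|<\pi$ by the convergent integral $$f(z)=\frac1{\ln q}\int_0^{\infty(d)}\frac{\Phi(\xi)}{\theta_q(\xi/z)}\,\frac{d\xi}{\xi},\qquad \theta_q(x)=\sum_{p\in\mathbb{Z}}q^{-p(p-1)/2}x^p .$$ **Theorem.** The following statements are equivalent. 1. There are a polynomial $P\in\mathbb{C}[z]$ with $P(0)\ne0$ and $g\in\mathbb{C}\{z\}$ such that $\hat f$ is the (unique) formal solution of $P(z\sigma_q)y=g$. 2. There are an integer $r\ge1$, numbers $a_1,\dots,a_r\in\mathbb{C}$ and constants $C,M>0$ such that for every $j>r$ $$\Big|\frac{f_j}{q^{j(j-1)/2}}-\sum_{k=j-r}^{j-1}a_{j-k}\frac{f_k}{q^{k(k-1)/2}}\Big|\le\frac{CM^j}{q^{j(j-1)/2}} .$$ 3. There are an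 integer $r\ge1$, numbers $a_1,\dots,a_r\in\mathbb{C}$, a polynomial $P\in\mathbb{C}[z]$ with $P(0)\neq0$ and $g\in\mathbb{C}\{z\}$ such that for every $d\in\mathbb{R}$ which is not an argument of a root of $h(z)=1-a_1z-\dots-a_rz^r$ the following holds: $\hat f$ is $q$-Gevrey summable in direction $d$ and has a $q$-Gevrey sum $f$ in direction $d$ on some sector $S_d(\theta,R)$ of opening $\pi\theta>2\pi$ which is a quasi-solution of $P(z\sigma_q)y=g$, that is, $P(z\sigma_q)f-g$ has the null series as its $q$-Gevrey asymptotic expansion in $S_d(\theta,\rho)$ for some $\rho>0$ so small that $q^{\deg P}\rho\le R$ and $\sum_p|g_p|\rho^p<\infty$, where $g=\sum_pg_pz^p$. Moreover, whenever $r\ge 1$ and $a_1,\dots,a_r$ are as in (2), the assertion in (3) holds with these same $r,a_1,\dots,a_r$ in the polynomial $h$ (and suitable $P,g$). -/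

import Mathlib

noncomputable section

open PowerSeries Set MeasureTheory

namespace QGevrey

/-! ### Formal power series -/

/-- The power series `g` converges absolutely on the closed disc of radius `ρ`. -/
def ConvergesAt (g : ℂ⟦X⟧) (ρ : ℝ) : Prop :=
  Summable fun p : ℕ => ‖coeff p g‖ * ρ ^ p

/-- `g ∈ ℂ{z}`: the power series `g` has a positive radius of convergence. -/
def IsConvergent (g : ℂ⟦X⟧) : Prop :=
  ∃ ρ : ℝ, 0 < ρ ∧ ConvergesAt g ρ

/-- The operator `z σ_q` on formal power series, `(z σ_q) y (z) = z * y (q z)`. -/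
def formalZSigma (q : ℝ) : Module.End ℂ ℂ⟦X⟧ where
  toFun y := X * rescale (q : ℂ) y
  map_add' y₁ y₂ := by rw [map_add, mul_add]
  map_smul' c y := by
    ext n
    cases n <;> simp [coeff_succ_X_mul, coeff_rescale, mul_left_comm]

/-- `P(z σ_q)` acting on formal power series. -/
def formalOp (q : ℝ) (P : Polynomial ℂ) : Module.End ℂ ℂ⟦X⟧ :=
  Polynomial.aeval (formalZSigma q) P

/-- The series `f` is `q`-Gevrey (of order one). -/
def IsQGevrey (q : ℝ) (f : ℂ⟦X⟧) : Prop :=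
  ∃ C A : ℝ, 0 < C ∧ 0 < A ∧ ∀ p : ℕ, ‖coeff p f‖ ≤ C * A ^ p * q ^ (p * (p - 1) / 2)

/-- The coefficients of the formal `q`-Borel transform of `f`, namely `f_p / q^{p(p-1)/2}`. -/
def borelCoeff (q : ℝ) (f : ℂ⟦X⟧) (p : ℕ) : ℂ :=
  coeff p f / (q : ℂ) ^ (p * (p - 1) / 2)

/-! ### Sectors of the Riemann surface of the logarithm

The Riemann surface of the logarithm is identified with `ℂ` through its global chart `log`: the
complex number `w` stands for the point `z` with `log z = w`, so that `|z| = exp w.re`,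
`arg z = w.im`, and the projection of `z` to `ℂ ∖ {0}` is `exp w`. Functions on sectors are
functions of `w`; holomorphy in `z` is holomorphy in `w`; and `z ↦ q z` is `w ↦ w + log q`. -/

/-- The bounded sector `S_d(θ, r)`, with opening `π θ`. -/
def sector (d θ r : ℝ) : Set ℂ :=
  {w | |w.im - d| < Real.pi * θ / 2 ∧ Real.exp w.re < r}

/-- The unbounded sector `S_d(θ)`, with opening `π θ`. -/
def unboundedSector (d θ : ℝ) : Set ℂ :=
  {w | |w.im - d| < Real.pi * θ / 2}

/-- The holomorphic function `F` admits `f` as its `q`-Gevrey asymptotic expansion in `G`: on each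
bounded proper subsector `T` of `G` (that is, the closure of `T` in the Riemann surface of the
logarithm is contained in `G`) one has
`|F(z) - ∑_{p < N} f_p z^p| ≤ C A^N q^{N(N-1)/2} |z|^N` for all `N`. -/
def HasQGevreyExpansion (q : ℝ) (G : Set ℂ) (F : ℂ → ℂ) (f : ℂ⟦X⟧) : Prop :=
  DifferentiableOn ℂ F G ∧
  ∀ d θ r : ℝ, 0 < θ → 0 < r → closure (sector d θ r) ⊆ G →
    ∃ C A : ℝ, 0 < C ∧ 0 < A ∧ ∀ N : ℕ, ∀ w ∈ sector d θ r,
      ‖F w - ∑ p ∈ Finset.range N, coeff p f * Complex.exp w ^ p‖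
        ≤ C * A ^ N * q ^ (N * (N - 1) / 2) * ‖Complex.exp w‖ ^ N

/-- The operator `z σ_q` on functions on the Riemann surface of the logarithm. -/
def zSigma (q : ℝ) : Module.End ℂ (ℂ → ℂ) where
  toFun F w := Complex.exp w * F (w + (Real.log q : ℂ))
  map_add' F₁ F₂ := by funext w; simp [mul_add]
  map_smul' c F := by funext w; simp [mul_left_comm]

/-- `P(z σ_q)` acting on functions. The value of `P(z σ_q) F` at `z` only involves the values of
`F` at `q^k z` with `0 ≤ k ≤ deg P`. -/
def functionOp (q : ℝ) (P : Polynomial ℂ) : Module.End ℂ (ℂ → ℂ) :=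
  Polynomial.aeval (zSigma q) P

/-! ### The `q`-Borel–Laplace method -/

/-- The Jacobi theta function `θ(z) = ∑_{p ∈ ℤ} q^{-p(p-1)/2} z^p`, for `z ≠ 0`. -/
def jacobiTheta (q : ℝ) (z : ℂ) : ℂ :=
  ∑' p : ℤ, (q : ℂ) ^ (-(p * (p - 1) / 2)) * z ^ p

/-- `Φ` is an analytic continuation of the formal `q`-Borel transform of `f` to the unbounded
sector `S_d(ε)`, with `|Φ(z)| ≤ C |z^μ exp((log z)^2 / (2 ln q))|` there. -/
def IsBorelContinuation (q : ℝ) (f : ℂ⟦X⟧) (d ε : ℝ) (Φ : ℂ → ℂ) : Prop :=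
  DifferentiableOn ℂ Φ (unboundedSector d ε) ∧
  (∃ ρ : ℝ, 0 < ρ ∧ ∀ w ∈ sector d ε ρ,
    HasSum (fun p : ℕ => borelCoeff q f p * Complex.exp w ^ p) (Φ w)) ∧
  ∃ C μ : ℝ, 0 < C ∧ ∀ w ∈ unboundedSector d ε,
    ‖Φ w‖ ≤ C * ‖Complex.exp (μ * w) * Complex.exp (w ^ 2 / (2 * Real.log q))‖

/-- `f` is `q`-Gevrey summable in direction `d`. -/
def QSummable (q : ℝ) (f : ℂ⟦X⟧) (d : ℝ) : Prop :=
  IsQGevrey q f ∧ ∃ ε : ℝ, 0 < ε ∧ ∃ Φ : ℂ → ℂ, IsBorelContinuation q f d ε Φ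

/-- The integrand, with respect to `ds` for `ξ = s e^{id}`, of
`∫_0^{∞(d)} Φ(ξ) / θ(ξ / z) dξ / ξ`, where `log z = w`. -/
def laplaceIntegrand (q d : ℝ) (Φ : ℂ → ℂ) (w : ℂ) (s : ℝ) : ℂ :=
  Φ (Real.log s + d * Complex.I) /
    jacobiTheta q (s * Complex.exp (d * Complex.I) / Complex.exp w) / s

/-- The `q`-Laplace transform of `Φ` in direction `d`, defined for `|arg z - d| < π` and small `|z|`.
The factor `1 / ln q` normalises the kernel, since `∫_0^∞ dt / (t θ(t)) = ln q`. -/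
def qLaplace (q d : ℝ) (Φ : ℂ → ℂ) (w : ℂ) : ℂ :=
  (1 / (Real.log q : ℂ)) * ∫ s in Ioi (0 : ℝ), laplaceIntegrand q d Φ w s

/-- `F` is the `q`-Gevrey sum of `f` in direction `d`, on the sector `S_d(θ, R)`: it is holomorphic
there and is the analytic continuation of the (convergent) `q`-Laplace integral in direction `d` of
the continued `q`-Borel transform of `f`. -/
def IsQSum (q : ℝ) (f : ℂ⟦X⟧) (d θ R : ℝ) (F : ℂ → ℂ) : Prop :=
  DifferentiableOn ℂ F (sector d θ R) ∧
  ∃ ε : ℝ, 0 < ε ∧ ∃ Φ : ℂ → ℂ, IsBorelContinuation q f d ε Φ ∧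
    ∀ w ∈ sector d θ R, |w.im - d| < Real.pi →
      IntegrableOn (laplaceIntegrand q d Φ w) (Ioi 0) ∧ F w = qLaplace q d Φ w

/-! ### The three conditions -/

/-- `f` is the formal solution of `P(z σ_q) y = g`. -/
def IsTheFormalSolution (q : ℝ) (P : Polynomial ℂ) (g f : ℂ⟦X⟧) : Prop :=
  ∀ y : ℂ⟦X⟧, formalOp q P y = g ↔ y = f

/-- The recurrence estimate of depth `r` with coefficients `a 1, …, a r`. -/
def RecurrenceEstimate (q : ℝ) (f : ℂ⟦X⟧) (r : ℕ) (a : ℕ → ℂ) : Prop :=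
  ∃ C M : ℝ, 0 < C ∧ 0 < M ∧ ∀ j : ℕ, r < j →
    ‖coeff j f / (q : ℂ) ^ (j * (j - 1) / 2)
        - ∑ k ∈ Finset.Ico (j - r) j, a (j - k) * (coeff k f / (q : ℂ) ^ (k * (k - 1) / 2))‖
      ≤ C * M ^ j / q ^ (j * (j - 1) / 2)

/-- The polynomial `h(z) = 1 - a_1 z - ⋯ - a_r z^r`. -/
def hPoly (r : ℕ) (a : ℕ → ℂ) : Polynomial ℂ :=
  1 - ∑ i ∈ Finset.Icc 1 r, Polynomial.C (a i) * Polynomial.X ^ i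

/-- `d` is an argument of a nonzero root of `h` (the polynomials `hPoly r a` do not vanish at `0`). -/
def IsRootArgument (h : Polynomial ℂ) (d : ℝ) : Prop :=
  ∃ t : ℝ, 0 < t ∧ h.IsRoot (t * Complex.exp (d * Complex.I))

/-- `F`, holomorphic on `S_d(θ, R)`, is a quasi-solution of `P(z σ_q) y = g`: on a sector
`S_d(θ, ρ)` so small that `P(z σ_q) F` and `g` are defined on it, `P(z σ_q) F - g` admits the null
series as its `q`-Gevrey asymptotic expansion. -/
def IsQuasiSolution (q : ℝ) (P : Polynomial ℂ) (g : ℂ⟦X⟧) (d θ R : ℝ) (F : ℂ → ℂ) : Prop :=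
  ∃ ρ : ℝ, 0 < ρ ∧ q ^ P.natDegree * ρ ≤ R ∧ ConvergesAt g ρ ∧
    HasQGevreyExpansion q (sector d θ ρ)
      (fun w => functionOp q P F w - ∑' p : ℕ, coeff p g * Complex.exp w ^ p) 0

/-- `f` is `q`-Gevrey summable in every direction other than the arguments of the roots of `h`, and
its sums, on sectors of opening larger than `2π`, are quasi-solutions of one and the same problem
`P(z σ_q) y = g` with `P(0) ≠ 0` and `g ∈ ℂ{z}`. -/
def SummableToQuasiSolution (q : ℝ) (f : ℂ⟦X⟧) (h : Polynomial ℂ) : Prop :=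
  ∃ (P : Polynomial ℂ) (g : ℂ⟦X⟧), P.eval 0 ≠ 0 ∧ IsConvergent g ∧
    ∀ d : ℝ, ¬ IsRootArgument h d →
      QSummable q f d ∧
      ∃ (θ R : ℝ) (F : ℂ → ℂ), 2 < θ ∧ 0 < R ∧ IsQSum q f d θ R F ∧
        IsQuasiSolution q P g d θ R F

end QGevrey

end

noncomputable section

open Complex Filter Topology MeasureTheory Set

namespace QGevrey

/-! ### The theta function in the logarithmic chart -/

/-! The formal q-Borel transform B divides the p-th coefficient by q^{p(p-1)/2}, which is exactly
the weight that turns zσ_q into multiplication by z (`formalBorel_formalOp`). So P(zσ_q)f = g reads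
P·Bf = Bg in the domain ℂ⟦z⟧, and uniqueness is automatic for P ≠ 0. Scale P so that P(0) = 1 and
call it h: the left side of the recurrence estimate is the j-th coefficient of B(h(zσ_q)f), so the
estimate says precisely that h(zσ_q)f converges (`recurrenceEstimate_iff`). This settles the
equivalence of the first two statements.

If g = h(zσ_q)f converges, then Bg is entire and dominated by a theta function, so it has the
Gaussian growth in log|ξ| allowed for a Borel transform, and Φ = Bg/h continues Bf in every
direction free of roots of h. The kernel 1/θ_q(ξ/z) decays at the same Gaussian rate, and for small
|z| the product is integrable. The functional equation of θ_q makes the Laplace transform intertwine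
multiplication by P with P(zσ_q) (`HasGrowth.functionOp_eq`), and the moments of 1/θ_q make it
invert B on convergent series (`logLaplace_borelSum`). Hence the sum F solves h(zσ_q)F = g exactly.
Since θ_q does not vanish off the negative axis (`logTheta_ne_zero`), each direction e near d gives
a function on |arg z - e| < π, and shifting contours glues these on an opening larger than 2π.

Conversely, one admissible direction and one ray suffice. The function PΦ - Bg has Laplace transform
P(zσ_q)F - g, which is flat. By a Watson lemma (`tendsto_laplace_leading`) the first nonzero Taylor
coefficient of PΦ - Bg would be visible in the leading term of that transform, so all of them vanish
and P·Bf = Bg.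

All analysis is done in the chart w = log z, where Laplace integrals become integrals of
Φ(u)/θ_q(e^{u-w}) over horizontal lines. -/

/-- The theta function in the logarithmic chart. -/
def logTheta (q : ℝ) (v : ℂ) : ℂ := jacobiTheta q (exp v)

lemma log_pos_of_one_lt {q : ℝ} (hq : 1 < q) : 0 < Real.log q := Real.log_pos hq

lemma ofReal_eq_exp_log {q : ℝ} (hq : 1 < q) : (q : ℂ) = exp (Real.log q : ℂ) := by
  rw [← ofReal_exp, Real.exp_log (by linarith)]

lemma cast_mul_pred_div_two (p : ℤ) : ((p * (p - 1) / 2 : ℤ) : ℂ) = p * (p - 1) / 2 := by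
  rw [Int.cast_div (Int.even_mul_pred_self p).two_dvd (by norm_num)]
  push_cast; ring

lemma natCast_mul_pred_div_two (p : ℕ) : ((p * (p - 1) / 2 : ℕ) : ℂ) = p * (p - 1) / 2 := by
  rw [Nat.cast_div (Nat.even_mul_pred_self p).two_dvd (by norm_num)]
  cases p <;> push_cast <;> simp

lemma natCast_real_mul_pred_div_two (p : ℕ) :
    ((p * (p - 1) / 2 : ℕ) : ℝ) = p * (p - 1) / 2 := by
  exact_mod_cast natCast_mul_pred_div_two p

lemma theta_term_eq_exp {q : ℝ} (hq : 1 < q) (p : ℤ) (v : ℂ) :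
    (q : ℂ) ^ (-(p * (p - 1) / 2)) * exp v ^ p =
      exp (p * v - Real.log q * (p * (p - 1) / 2)) := by
  rw [ofReal_eq_exp_log hq, ← exp_int_mul, ← exp_int_mul, ← Complex.exp_add]
  rw [Int.cast_neg, cast_mul_pred_div_two]
  ring_nf

/-- Completing the dictionary with the two-variable Jacobi theta function, τ = i ln q/(2π) in the
upper half plane; convergence and holomorphy are inherited from there. -/
lemma theta_term_eq {q : ℝ} (hq : 1 < q) (p : ℤ) (v : ℂ) :
    (q : ℂ) ^ (-(p * (p - 1) / 2)) * exp v ^ p =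
      jacobiTheta₂_term p ((v + Real.log q / 2) / (2 * Real.pi * I))
        (I * Real.log q / (2 * Real.pi)) := by
  rw [theta_term_eq_exp hq, jacobiTheta₂_term]
  congr 1
  have : (Real.pi : ℂ) ≠ 0 := by exact_mod_cast Real.pi_ne_zero
  have h2 := I_ne_zero
  field_simp
  rw [I_sq]
  ring

lemma theta_tau_im_pos {q : ℝ} (hq : 1 < q) :
    0 < (I * Real.log q / (2 * Real.pi) : ℂ).im := by
  have : (I * Real.log q / (2 * Real.pi) : ℂ) = ((Real.log q / (2 * Real.pi) : ℝ) : ℂ) * I := by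
    push_cast; ring
  rw [this, im_ofReal_mul, I_im, mul_one]
  have := log_pos_of_one_lt hq
  positivity

lemma logTheta_eq {q : ℝ} (hq : 1 < q) (v : ℂ) :
    logTheta q v = jacobiTheta₂ ((v + Real.log q / 2) / (2 * Real.pi * I))
        (I * Real.log q / (2 * Real.pi)) := by
  simp only [logTheta, jacobiTheta, jacobiTheta₂, theta_term_eq hq]

lemma hasSum_logTheta {q : ℝ} (hq : 1 < q) (v : ℂ) :
    HasSum (fun p : ℤ => exp (p * v - Real.log q * (p * (p - 1) / 2))) (logTheta q v) := by
  have := hasSum_jacobiTheta₂_term ((v + Real.log q / 2) / (2 * Real.pi * I))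
    (theta_tau_im_pos hq)
  rw [logTheta_eq hq]
  refine this.congr_fun fun p => ?_
  rw [← theta_term_eq hq, theta_term_eq_exp hq]

lemma differentiable_logTheta {q : ℝ} (hq : 1 < q) : Differentiable ℂ (logTheta q) := by
  intro v
  have h1 : logTheta q = (fun z => jacobiTheta₂ z (I * Real.log q / (2 * Real.pi))) ∘
      fun v : ℂ => (v + Real.log q / 2) / (2 * Real.pi * I) := by
    funext v; exact logTheta_eq hq v
  rw [h1]
  exact (differentiableAt_jacobiTheta₂_fst _ (theta_tau_im_pos hq)).comp v (by fun_prop)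

/-- The shift p ↦ p + n of the summation index. This functional equation yields the Gaussian bounds,
the moments of 1/θ and the intertwining property of the Laplace transform. -/
lemma logTheta_add_int_mul_log {q : ℝ} (hq : 1 < q) (v : ℂ) (n : ℤ) :
    logTheta q (v + n * Real.log q) =
      exp (n * v + Real.log q * (n * (n + 1) / 2)) * logTheta q v := by
  have h := (hasSum_logTheta hq v).mul_left (exp (n * v + Real.log q * (n * (n + 1) / 2)))
  have h' := (Equiv.hasSum_iff (Equiv.addRight n)).2 (hasSum_logTheta hq (v + n * Real.log q))
  refine (h'.congr_fun fun p => ?_).unique h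
  simp only [Function.comp, Equiv.coe_addRight, ← Complex.exp_add]
  congr 1; push_cast; ring

/-- On the real line the theta function is real and positive. -/
lemma exists_logTheta_ofReal {q : ℝ} (hq : 1 < q) (t : ℝ) :
    0 < ‖logTheta q t‖ ∧ logTheta q t = (‖logTheta q t‖ : ℝ) := by
  have h := hasSum_logTheta hq (t : ℂ)
  have h2 : ∀ p : ℤ, exp (p * t - Real.log q * (p * (p - 1) / 2)) =
      ((Real.exp (p * t - Real.log q * (p * (p - 1) / 2)) : ℝ) : ℂ) := by
    intro p; push_cast; rfl
  simp only [h2] at h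
  have hs : Summable fun p : ℤ => Real.exp (p * t - Real.log q * (p * (p - 1) / 2)) :=
    Complex.summable_ofReal.1 h.summable
  have h3 : logTheta q t = ((∑' p : ℤ, Real.exp (p * t - Real.log q * (p * (p - 1) / 2)) : ℝ) : ℂ) := by
    rw [← h.tsum_eq, Complex.ofReal_tsum]
  have hpos : 0 < ∑' p : ℤ, Real.exp (p * t - Real.log q * (p * (p - 1) / 2)) :=
    hs.tsum_pos (fun _ => (Real.exp_pos _).le) 0 (Real.exp_pos _)
  rw [h3, Complex.norm_real, Real.norm_eq_abs, abs_of_pos hpos]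
  exact ⟨hpos, rfl⟩

end QGevrey

end

noncomputable section

open Complex Filter Topology MeasureTheory Set

namespace QGevrey

/-! ### Gaussian binomial coefficients and zeros of the theta function -/

/-- The Gaussian binomial coefficients, by the `q`-Pascal rule. -/
def gaussBinom (p : ℂ) : ℕ → ℕ → ℂ
  | _, 0 => 1
  | 0, _ + 1 => 0
  | n + 1, j + 1 => gaussBinom p n j + p ^ (j + 1) * gaussBinom p n (j + 1)

/-- The `q`-Pochhammer symbol `(p; p)_n`. -/
def qPochhammer (p : ℂ) (n : ℕ) : ℂ := ∏ i ∈ Finset.range n, (1 + -p ^ (i + 1))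

lemma gaussBinom_zero_right (p : ℂ) (n : ℕ) : gaussBinom p n 0 = 1 := by
  cases n <;> rfl

lemma gaussBinom_succ_succ (p : ℂ) (n j : ℕ) :
    gaussBinom p (n + 1) (j + 1) = gaussBinom p n j + p ^ (j + 1) * gaussBinom p n (j + 1) := rfl

lemma gaussBinom_eq_zero_of_lt (p : ℂ) : ∀ {n j : ℕ}, n < j → gaussBinom p n j = 0
  | 0, 0, h => absurd h (lt_irrefl _)
  | 0, _ + 1, _ => rfl
  | n + 1, 0, h => absurd h (by omega)
  | n + 1, j + 1, h => by
    rw [gaussBinom_succ_succ, gaussBinom_eq_zero_of_lt p (by omega : n < j),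
      gaussBinom_eq_zero_of_lt p (by omega : n < j + 1)]
    ring

lemma qPochhammer_succ (p : ℂ) (n : ℕ) :
    qPochhammer p (n + 1) = qPochhammer p n * (1 - p ^ (n + 1)) := by
  rw [qPochhammer, Finset.prod_range_succ, ← qPochhammer, sub_eq_add_neg]

/-- The factorial formula in division-free form, so that induction by the Pascal rule works for
every p; one divides only once ‖p‖ < 1. -/
lemma gaussBinom_mul (p : ℂ) (n : ℕ) : ∀ j k : ℕ, j + k = n →
    gaussBinom p n j * (qPochhammer p j * qPochhammer p k) = qPochhammer p n := by
  induction n with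
  | zero =>
    intro j k h
    obtain ⟨rfl, rfl⟩ : j = 0 ∧ k = 0 := by omega
    simp [gaussBinom, qPochhammer]
  | succ n ih =>
    intro j k h
    rcases j with _ | j
    · obtain rfl : k = n + 1 := by omega
      simp [gaussBinom, qPochhammer]
    rw [gaussBinom_succ_succ]
    rcases k with _ | k
    · obtain rfl : j = n := by omega
      rw [gaussBinom_eq_zero_of_lt p (by omega : j < j + 1)]
      have := ih j 0 (by omega)
      rw [qPochhammer_succ]
      linear_combination (1 - p ^ (j + 1)) * this
    · have h1 := ih j (k + 1) (by omega)
      have h2 := ih (j + 1) k (by omega)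
      have h3 : p ^ (n + 1) = p ^ (j + 1) * p ^ (k + 1) := by
        rw [← pow_add]; congr 1; omega
      rw [qPochhammer_succ p n, h3]
      rw [qPochhammer_succ p j] at h2 ⊢
      rw [qPochhammer_succ p k] at h1 ⊢
      linear_combination (1 - p ^ (j + 1)) * h1 + p ^ (j + 1) * (1 - p ^ (k + 1)) * h2

/-- The `q`-binomial theorem. -/
lemma prod_one_add_mul_pow (p : ℂ) (n : ℕ) : ∀ y : ℂ,
    ∏ k ∈ Finset.range n, (1 + y * p ^ k) =
      ∑ j ∈ Finset.range (n + 1), p ^ (j * (j - 1) / 2) * gaussBinom p n j * y ^ j := by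
  induction n with
  | zero => intro y; simp [gaussBinom]
  | succ n ih =>
    intro y
    have h1 : ∏ k ∈ Finset.range (n + 1), (1 + y * p ^ k) =
        (∏ k ∈ Finset.range n, (1 + (y * p) * p ^ k)) * (1 + y) := by
      rw [Finset.prod_range_succ']
      simp only [pow_zero, mul_one, pow_succ']
      congr 1
      refine Finset.prod_congr rfl fun k _ => by ring
    have h2 : ∀ j : ℕ, (j + 1) * (j + 1 - 1) / 2 = j * (j - 1) / 2 + j := by
      intro j
      rw [← Nat.choose_two_right, ← Nat.choose_two_right, Nat.choose_succ_succ' j 1]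
      simp; ring
    rw [h1, ih, mul_add, mul_one, Finset.sum_range_succ' _ (n + 1)]
    simp only [gaussBinom_succ_succ, gaussBinom_zero_right, h2]
    have h3 : ∑ j ∈ Finset.range (n + 1), p ^ (j * (j - 1) / 2) * gaussBinom p n j * (y * p) ^ j =
        ∑ j ∈ Finset.range (n + 1), p ^ (j * (j - 1) / 2 + j) * (p ^ (j + 1) *
          gaussBinom p n (j + 1)) * y ^ (j + 1) + 1 := by
      have := Finset.sum_range_succ' (fun j => p ^ (j * (j - 1) / 2) * gaussBinom p n j * (y * p) ^ j)
        (n + 1)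
      rw [Finset.sum_range_succ, gaussBinom_eq_zero_of_lt p (Nat.lt_succ_self n)] at this
      simp only [mul_zero, zero_mul, add_zero, gaussBinom_zero_right, h2] at this
      rw [this]
      simp only [pow_zero, mul_one, Nat.zero_div]
      congr 1
      refine Finset.sum_congr rfl fun j _ => by ring
    nth_rewrite 1 [h3]
    rw [Finset.sum_mul, add_right_comm, ← Finset.sum_add_distrib]
    simp only [pow_zero, mul_one, Nat.zero_div, zero_mul]
    congr 1
    refine Finset.sum_congr rfl fun j _ => by ring

/-- In this strip the principal logarithm inverts exp, whereas log(-1) = πi lies on its boundary.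
The restriction |arg| < π enters the theory here. -/
lemma exp_ne_neg_one {z : ℂ} (hz : |z.im| < Real.pi) : 1 + exp z ≠ 0 := by
  intro h
  have h1 : exp z = -1 := by linear_combination h
  have h2 := Complex.log_exp (abs_lt.1 hz).1 (abs_lt.1 hz).2.le
  rw [h1, Complex.log_neg_one] at h2
  rw [← h2] at hz
  simp [abs_of_pos Real.pi_pos] at hz

/-! ### Limits of the finite triple product and non-vanishing of theta -/

section

variable {q : ℝ}

lemma norm_exp_neg_log_lt_one (hq : 1 < q) : ‖exp (-(Real.log q : ℂ))‖ < 1 := by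
  rw [Complex.norm_exp]
  have := log_pos_of_one_lt hq
  simpa using this

lemma summable_norm_exp_sub (hq : 1 < q) (v : ℂ) :
    Summable fun k : ℕ => ‖exp (v - k * Real.log q)‖ := by
  have h : ∀ k : ℕ, ‖exp (v - k * Real.log q)‖ = ‖exp v‖ * ‖exp (-(Real.log q : ℂ))‖ ^ k := by
    intro k
    rw [← norm_pow, ← norm_mul, ← Complex.exp_nat_mul, ← Complex.exp_add]
    ring_nf
  simp only [h]
  exact (summable_geometric_of_lt_one (norm_nonneg _) (norm_exp_neg_log_lt_one hq)).mul_left _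

lemma tendsto_prod_one_add_exp (hq : 1 < q) {v : ℂ} (hv : |v.im| < Real.pi) :
    ∃ c : ℂ, c ≠ 0 ∧ Tendsto (fun m => ∏ k ∈ Finset.range m, (1 + exp (v - k * Real.log q)))
      atTop (𝓝 c) := by
  refine ⟨_, tprod_one_add_ne_zero_of_summable (fun k => exp_ne_neg_one ?_)
    (summable_norm_exp_sub hq v),
    (multipliable_one_add_of_summable (summable_norm_exp_sub hq v)).tendsto_prod_tprod_nat⟩
  simpa [Complex.sub_im, Complex.mul_im] using hv

lemma qPochhammer_factor_ne_zero {p : ℂ} (hp : ‖p‖ < 1) (i : ℕ) : 1 + -p ^ (i + 1) ≠ 0 := by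
  intro h
  have h1 : p ^ (i + 1) = 1 := by linear_combination -h
  have h2 : ‖p‖ ^ (i + 1) < 1 := pow_lt_one₀ (norm_nonneg _) hp (by omega)
  rw [← norm_pow, h1] at h2
  simp at h2

lemma qPochhammer_ne_zero {p : ℂ} (hp : ‖p‖ < 1) (n : ℕ) : qPochhammer p n ≠ 0 :=
  Finset.prod_ne_zero_iff.2 fun i _ => qPochhammer_factor_ne_zero hp i

lemma tendsto_qPochhammer {p : ℂ} (hp : ‖p‖ < 1) :
    ∃ c : ℂ, c ≠ 0 ∧ Tendsto (qPochhammer p) atTop (𝓝 c) := by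
  have hs : Summable fun i : ℕ => ‖-p ^ (i + 1)‖ := by
    simpa [norm_neg, norm_pow] using
      (summable_nat_add_iff 1).2 (summable_geometric_of_lt_one (norm_nonneg _) hp)
  exact ⟨_, tprod_one_add_ne_zero_of_summable (fun i => qPochhammer_factor_ne_zero hp i) hs,
    (multipliable_one_add_of_summable hs).tendsto_prod_tprod_nat⟩

lemma gaussBinom_eq_div {p : ℂ} (hp : ‖p‖ < 1) {n j k : ℕ} (h : j + k = n) :
    gaussBinom p n j = qPochhammer p n / (qPochhammer p j * qPochhammer p k) := by
  rw [eq_div_iff (mul_ne_zero (qPochhammer_ne_zero hp _) (qPochhammer_ne_zero hp _))]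
  exact gaussBinom_mul p n j k h

/-- A convergent sequence with nonzero limit and no zero terms is bounded together with its inverse.
The uniform bound supplies the domination in `logTheta_ne_zero`. -/
lemma exists_gaussBinom_bound {p : ℂ} (hp : ‖p‖ < 1) :
    ∃ M : ℝ, ∀ n j : ℕ, ‖gaussBinom p n j‖ ≤ M := by
  obtain ⟨c, hc, hlim⟩ := tendsto_qPochhammer hp
  obtain ⟨A, hA⟩ := (Metric.isBounded_range_of_tendsto _ hlim).exists_norm_le
  obtain ⟨B, hB⟩ := (Metric.isBounded_range_of_tendsto _ (hlim.inv₀ hc)).exists_norm_le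
  have hA' : ∀ n, ‖qPochhammer p n‖ ≤ A := fun n => hA _ ⟨n, rfl⟩
  have hB' : ∀ n, ‖(qPochhammer p n)⁻¹‖ ≤ B := fun n => hB _ ⟨n, rfl⟩
  have hA0 : 0 ≤ A := (norm_nonneg _).trans (hA' 0)
  have hB0 : 0 ≤ B := (norm_nonneg _).trans (hB' 0)
  refine ⟨A * (B * B), fun n j => ?_⟩
  rcases le_or_gt j n with h | h
  · rw [gaussBinom_eq_div hp (Nat.add_sub_cancel' h), div_eq_mul_inv, mul_inv, norm_mul, norm_mul]
    gcongr
    exacts [hA' n, hB' _, hB' _]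
  · rw [gaussBinom_eq_zero_of_lt p h, norm_zero]; positivity

/-- Around the middle of row 2m every Gaussian binomial tends to the same value 1/(p; p)_∞. Only its
being nonzero and independent of j matters. -/
lemma tendsto_gaussBinom {p : ℂ} (hp : ‖p‖ < 1) :
    ∃ c : ℂ, c ≠ 0 ∧ ∀ j : ℤ,
      Tendsto (fun m : ℕ => if 0 ≤ j + m then gaussBinom p (2 * m) (j + m).toNat else 0)
        atTop (𝓝 c) := by
  obtain ⟨c, hc, hlim⟩ := tendsto_qPochhammer hp
  refine ⟨c / (c * c), div_ne_zero hc (mul_ne_zero hc hc), fun j => ?_⟩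
  have h1 : Tendsto (fun m : ℕ => (j + m).toNat) atTop atTop := by
    refine tendsto_atTop.2 fun b => ?_
    filter_upwards [eventually_ge_atTop (b + j.natAbs)] with m hm
    omega
  have h2 : Tendsto (fun m : ℕ => (m - j).toNat) atTop atTop := by
    refine tendsto_atTop.2 fun b => ?_
    filter_upwards [eventually_ge_atTop (b + j.natAbs)] with m hm
    omega
  have h3 : Tendsto (fun m : ℕ => 2 * m) atTop atTop :=
    tendsto_atTop.2 fun b => by
      filter_upwards [eventually_ge_atTop b] with m hm
      omega
  refine ((hlim.comp h3).div ((hlim.comp h1).mul (hlim.comp h2)) (mul_ne_zero hc hc)).congr' ?_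
  filter_upwards [eventually_ge_atTop j.natAbs] with m hm
  rw [if_pos (by omega), gaussBinom_eq_div hp (k := (m - j).toNat) (by omega)]
  rfl

/-- The finite form of the Jacobi triple product. -/
lemma finite_triple_product (v : ℂ) (m : ℕ) :
    (∏ k ∈ Finset.range m, (1 + exp (v - k * Real.log q))) *
      ∏ k ∈ Finset.range m, (1 + exp (-v - Real.log q - k * Real.log q)) =
    ∑' j : ℤ, (if 0 ≤ j + m then gaussBinom (exp (-(Real.log q : ℂ))) (2 * m) (j + m).toNat else 0) *
      exp (j * v - Real.log q * (j * (j - 1) / 2)) := by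
  set L : ℂ := (Real.log q : ℂ)
  set p := exp (-L) with hp
  have hpk : ∀ k : ℕ, p ^ k = exp (-(k * L)) := by
    intro k; rw [hp, ← Complex.exp_nat_mul]; ring_nf
  have hE : ∏ k ∈ Finset.range m, exp (v + (k + 1) * L) = exp (m * v + L * (m * (m + 1) / 2)) := by
    induction m with
    | zero => simp
    | succ m ih =>
      rw [Finset.prod_range_succ, ih, ← Complex.exp_add]
      congr 1; push_cast; ring
  -- With this y the last m factors are 1 + e^{v-kL}, and the first m are 1 + e^{v+kL} with k ≥ 1.
  -- Pulling e^{v+kL} out of the latter centres the sum at index m.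
  have h1 := prod_one_add_mul_pow p (2 * m) (exp (v + m * L))
  rw [two_mul, Finset.prod_range_add, ← two_mul] at h1
  have h2 : ∏ k ∈ Finset.range m, (1 + exp (v + m * L) * p ^ (m + k)) =
      ∏ k ∈ Finset.range m, (1 + exp (v - k * L)) := by
    refine Finset.prod_congr rfl fun k _ => ?_
    rw [hpk, ← Complex.exp_add]; congr 2; push_cast; ring
  have h3 : ∏ k ∈ Finset.range m, (1 + exp (v + m * L) * p ^ k) =
      exp (m * v + L * (m * (m + 1) / 2)) * ∏ k ∈ Finset.range m, (1 + exp (-v - L - k * L)) := by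
    rw [← hE, ← Finset.prod_mul_distrib, ← Finset.prod_range_reflect]
    refine Finset.prod_congr rfl fun k hk => ?_
    have hk' := Finset.mem_range.1 hk
    rw [hpk, mul_add, ← Complex.exp_add, ← Complex.exp_add, add_comm (1 : ℂ)]
    have : ((m - 1 - k : ℕ) : ℂ) = m - 1 - k := by
      rw [Nat.cast_sub (by omega), Nat.cast_sub (by omega)]; simp
    rw [this]
    congr 1
    · rw [mul_one]; congr 1; ring
    · rw [show v + (k + 1) * L + (-v - L - k * L) = 0 by ring, Complex.exp_zero]
  rw [h2, h3] at h1
  have h4 : ∑' j : ℤ, (if 0 ≤ j + m then gaussBinom p (2 * m) (j + m).toNat else 0) *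
      exp (j * v - L * (j * (j - 1) / 2)) =
      ∑ i ∈ Finset.range (2 * m + 1), gaussBinom p (2 * m) i *
        exp (((i : ℂ) - m) * v - L * (((i : ℂ) - m) * ((i : ℂ) - m - 1) / 2)) := by
    have hinj : Function.Injective fun i : ℕ => (i : ℤ) - m := fun a b h => by
      simp only at h; omega
    rw [tsum_eq_sum (s := (Finset.range (2 * m + 1)).map ⟨_, hinj⟩), Finset.sum_map]
    · refine Finset.sum_congr rfl fun i _ => ?_
      simp only [Function.Embedding.coeFn_mk]
      rw [if_pos (by omega)]
      congr 1
      · congr 1; omega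
      · push_cast; rfl
    · intro j hj
      split_ifs with h
      · rw [gaussBinom_eq_zero_of_lt, zero_mul]
        by_contra hlt
        refine hj (Finset.mem_map.2 ⟨(j + m).toNat, Finset.mem_range.2 (by omega), ?_⟩)
        simp only [Function.Embedding.coeFn_mk]
        omega
      · rw [zero_mul]
  rw [h4]
  have h5 := Complex.exp_ne_zero (m * v + L * (m * (m + 1) / 2))
  refine mul_left_cancel₀ h5 ?_
  rw [mul_left_comm, mul_comm (∏ k ∈ Finset.range m, (1 + exp (v - k * L))), h1, Finset.mul_sum]
  refine Finset.sum_congr rfl fun i _ => ?_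
  rw [hpk, natCast_mul_pred_div_two, ← Complex.exp_nat_mul, mul_left_comm, ← Complex.exp_add,
    mul_comm (exp _), mul_assoc, ← Complex.exp_add]
  congr 2; ring

/-- Let m → ∞ in the finite triple product: by dominated convergence c·θ = a·b, where a and b are
convergent products of nonzero factors. -/
lemma logTheta_ne_zero (hq : 1 < q) {v : ℂ} (hv : |v.im| < Real.pi) : logTheta q v ≠ 0 := by
  have hp := norm_exp_neg_log_lt_one hq
  obtain ⟨a, ha, hla⟩ := tendsto_prod_one_add_exp hq hv
  obtain ⟨b, hb, hlb⟩ := tendsto_prod_one_add_exp hq (v := -v - Real.log q) (by simpa using hv)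
  obtain ⟨c, hc, hlc⟩ := tendsto_gaussBinom hp
  obtain ⟨M, hM⟩ := exists_gaussBinom_bound hp
  have hlim := tendsto_tsum_of_dominated_convergence
    (bound := fun j : ℤ => M * ‖exp (j * v - Real.log q * (j * (j - 1) / 2))‖)
    (f := fun (m : ℕ) (j : ℤ) =>
      (if 0 ≤ j + m then gaussBinom (exp (-(Real.log q : ℂ))) (2 * m) (j + m).toNat else 0) *
      exp (j * v - Real.log q * (j * (j - 1) / 2)))
    (g := fun j => c * exp (j * v - Real.log q * (j * (j - 1) / 2)))
    ((hasSum_logTheta hq v).summable.norm.mul_left M)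
    (fun j => (hlc j).mul_const _)
    (Eventually.of_forall fun m j => by
      rw [norm_mul]
      refine mul_le_mul_of_nonneg_right ?_ (norm_nonneg _)
      split_ifs
      · exact hM _ _
      · rw [norm_zero]; exact (norm_nonneg _).trans (hM 0 0))
  simp only [← finite_triple_product] at hlim
  have h := tendsto_nhds_unique hlim (hla.mul hlb)
  rw [tsum_mul_left, (hasSum_logTheta hq v).tsum_eq] at h
  intro h0
  rw [h0, mul_zero] at h
  exact mul_ne_zero ha hb h.symm

end

end QGevrey

end

noncomputable section

open Complex Filter Topology MeasureTheory Set

namespace QGevrey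

variable {q : ℝ}

/-! ### Gaussian bounds and moments of the theta function -/

/-- By the functional equation |θ| divided by its Gaussian is periodic of period ln q in Re v.
Bounds on strips thus reduce to compactness of a rectangle. -/
lemma exists_fundamental_translate (hq : 1 < q) (v : ℂ) :
    ∃ v₀ : ℂ, v₀.re ∈ Icc 0 (Real.log q) ∧ v₀.im = v.im ∧
      ‖logTheta q v‖ * Real.exp (-(v.re ^ 2 / (2 * Real.log q) + v.re / 2)) =
        ‖logTheta q v₀‖ * Real.exp (-(v₀.re ^ 2 / (2 * Real.log q) + v₀.re / 2)) := by
  have hL := log_pos_of_one_lt hq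
  set L := Real.log q
  set n : ℤ := ⌊v.re / L⌋
  have h1 : (n : ℝ) * L ≤ v.re := (le_div_iff₀ hL).1 (Int.floor_le _)
  have h2 : v.re < (n + 1) * L := (div_lt_iff₀ hL).1 (Int.lt_floor_add_one _)
  refine ⟨v - n * L, ⟨?_, ?_⟩, ?_, ?_⟩
  · simp [Complex.sub_re, Complex.mul_re]; linarith
  · simp [Complex.sub_re, Complex.mul_re]; linarith
  · simp [Complex.sub_im, Complex.mul_im]
  · have h3 : v = (v - n * L) + n * (Real.log q : ℝ) := by simp [L]
    conv_lhs => rw [h3, logTheta_add_int_mul_log hq, norm_mul, Complex.norm_exp, mul_right_comm,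
      ← Real.exp_add]
    rw [mul_comm]
    congr 2
    have e1 : ((n : ℂ) * (v - n * L) + Real.log q * (n * (n + 1) / 2)).re =
        n * (v.re - n * L) + L * (n * (n + 1) / 2) := by
      have : ((n : ℂ) * (v - n * L) + Real.log q * (n * (n + 1) / 2)) =
        (n : ℝ) * v + ((-n * n * L + L * (n * (n + 1) / 2) : ℝ) : ℂ) := by push_cast; ring
      rw [this, add_re, re_ofReal_mul, ofReal_re]; ring
    have e2 : (v - n * L + n * (Real.log q : ℝ)).re = v.re := by rw [← h3]
    have e3 : (v - n * L).re = v.re - n * L := by simp [Complex.mul_re]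
    rw [e1, e2, e3]
    field_simp
    ring

lemma isCompact_rect (L b : ℝ) : IsCompact (Icc 0 L ×ℂ Icc (-b) b) :=
  isCompact_Icc.reProdIm isCompact_Icc

/-- Gaussian upper bound for the theta function on horizontal strips. -/
lemma exists_norm_logTheta_le (hq : 1 < q) (b : ℝ) :
    ∃ C : ℝ, 0 < C ∧ ∀ v : ℂ, |v.im| ≤ b →
      ‖logTheta q v‖ ≤ C * Real.exp (v.re ^ 2 / (2 * Real.log q) + v.re / 2) := by
  have hc : Continuous fun v : ℂ => ‖logTheta q v‖ *
      Real.exp (-(v.re ^ 2 / (2 * Real.log q) + v.re / 2)) := by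
    have := (differentiable_logTheta hq).continuous
    fun_prop
  obtain ⟨C, hC⟩ := (isCompact_rect (Real.log q) b).exists_bound_of_continuousOn hc.continuousOn
  refine ⟨max C 1, by positivity, fun v hv => ?_⟩
  obtain ⟨v₀, h1, h2, h3⟩ := exists_fundamental_translate hq v
  have h4 := (le_abs_self _).trans (hC v₀ ⟨h1, by rw [mem_preimage, h2]; exact abs_le.1 hv⟩)
  rw [← h3, Real.exp_neg, ← div_eq_mul_inv, div_le_iff₀ (Real.exp_pos _)] at h4
  exact h4.trans (by gcongr; exact le_max_left _ _)

/-- Gaussian bound for the inverse of the theta function away from its zeros. -/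
lemma exists_norm_inv_logTheta_le (hq : 1 < q) {b : ℝ} (hb : b < Real.pi) :
    ∃ C : ℝ, 0 < C ∧ ∀ v : ℂ, |v.im| ≤ b →
      ‖(logTheta q v)⁻¹‖ ≤ C * Real.exp (-(v.re ^ 2 / (2 * Real.log q) + v.re / 2)) := by
  have hc : ContinuousOn (fun v : ℂ => ‖(logTheta q v)⁻¹‖ *
      Real.exp (v.re ^ 2 / (2 * Real.log q) + v.re / 2)) (Icc 0 (Real.log q) ×ℂ Icc (-b) b) := by
    have h1 : ContinuousOn (fun v : ℂ => (logTheta q v)⁻¹)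
        (Icc 0 (Real.log q) ×ℂ Icc (-b) b) :=
      (differentiable_logTheta hq).continuous.continuousOn.inv₀ fun v hv =>
        logTheta_ne_zero hq ((abs_le.2 hv.2).trans_lt hb)
    refine h1.norm.mul (Continuous.continuousOn (by fun_prop))
  obtain ⟨C, hC⟩ := (isCompact_rect (Real.log q) b).exists_bound_of_continuousOn hc
  refine ⟨max C 1, by positivity, fun v hv => ?_⟩
  obtain ⟨v₀, h1, h2, h3⟩ := exists_fundamental_translate hq v
  have h4 := (le_abs_self _).trans (hC v₀ ⟨h1, by rw [mem_preimage, h2]; exact abs_le.1 hv⟩)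
  have h5 := congrArg (·⁻¹) h3
  simp only [mul_inv, ← Real.exp_neg, neg_neg, ← norm_inv] at h5
  rw [← h5] at h4
  rw [Real.exp_neg, ← div_eq_mul_inv, le_div_iff₀ (Real.exp_pos _)]
  exact h4.trans (le_max_left _ _)

/-! ### Integrability and moments of the kernel 1/θ on the positive axis -/

lemma integrable_exp_quadratic {b : ℝ} (hb : 0 < b) (c : ℝ) :
    Integrable fun t : ℝ => Real.exp (-b * t ^ 2 + c * t) := by
  have h := (integrable_cexp_quadratic' (b := (-b : ℂ)) (by simpa using hb) (c : ℂ) 0).norm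
  refine h.congr (Eventually.of_forall fun t => ?_)
  simp only [Complex.norm_exp]
  congr 1
  have : (-(b : ℂ) * (t : ℂ) ^ 2 + c * t + 0) = ((-b * t ^ 2 + c * t : ℝ) : ℂ) := by
    push_cast; ring
  rw [this, ofReal_re]

lemma continuous_inv_norm_logTheta_ofReal (hq : 1 < q) :
    Continuous fun t : ℝ => ‖logTheta q t‖⁻¹ := by
  have h := (differentiable_logTheta hq).continuous
  exact (h.comp continuous_ofReal).norm.inv₀ fun t => (exists_logTheta_ofReal hq t).1.ne'

lemma integrable_exp_mul_inv_norm_logTheta (hq : 1 < q) (c : ℝ) :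
    Integrable fun t : ℝ => Real.exp (c * t) * ‖logTheta q t‖⁻¹ := by
  have hL := log_pos_of_one_lt hq
  obtain ⟨C, hC, h⟩ := exists_norm_inv_logTheta_le hq Real.pi_pos
  refine ((integrable_exp_quadratic (b := 1 / (2 * Real.log q)) (by positivity)
    (c - 1 / 2)).const_mul C).mono' ?_ (Eventually.of_forall fun t => ?_)
  · exact (Continuous.mul (by fun_prop) (continuous_inv_norm_logTheta_ofReal hq)).aestronglyMeasurable
  · have h1 := h t (by simp)
    rw [Real.norm_of_nonneg (by positivity)]
    rw [norm_inv, ofReal_re] at h1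
    calc _ ≤ Real.exp (c * t) * (C * Real.exp (-(t ^ 2 / (2 * Real.log q) + t / 2))) := by gcongr
      _ = _ := by
        rw [mul_left_comm, ← Real.exp_add]
        congr 2; ring

lemma norm_logTheta_ofReal_add (hq : 1 < q) (t : ℝ) (n : ℤ) :
    ‖logTheta q ((t + n * Real.log q : ℝ) : ℂ)‖ =
      Real.exp (n * t + Real.log q * (n * (n + 1) / 2)) * ‖logTheta q t‖ := by
  push_cast
  rw [logTheta_add_int_mul_log hq, norm_mul, Complex.norm_exp]
  congr 2
  have : ((n : ℂ) * t + Real.log q * (n * (n + 1) / 2)) =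
    ((n * t + Real.log q * (n * (n + 1) / 2) : ℝ) : ℂ) := by push_cast; ring
  rw [this, ofReal_re]

lemma hasSum_norm_logTheta (hq : 1 < q) (t : ℝ) :
    HasSum (fun p : ℤ => Real.exp (p * t - Real.log q * (p * (p - 1) / 2))) ‖logTheta q t‖ := by
  have h := hasSum_logTheta hq (t : ℂ)
  rw [(exists_logTheta_ofReal hq t).2] at h
  rw [← Complex.hasSum_ofReal]
  refine h.congr_fun fun p => ?_
  push_cast; rfl

lemma pow_mul_pred_div_two (hq : 1 < q) (p : ℕ) :
    q ^ (p * (p - 1) / 2) = Real.exp (Real.log q * (p * (p - 1) / 2)) := by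
  rw [← natCast_real_mul_pred_div_two, mul_comm (Real.log q), Real.exp_nat_mul, Real.exp_log (by linarith)]

/-- The moments of the kernel `1 / θ`. -/
lemma integral_exp_mul_inv_norm_logTheta (hq : 1 < q) (p : ℕ) :
    ∫ t : ℝ, Real.exp (p * t) * ‖logTheta q t‖⁻¹ = Real.log q * q ^ (p * (p - 1) / 2) := by
  have hL := log_pos_of_one_lt hq
  set L := Real.log q with hLdef
  set f : ℝ → ℝ := fun t => Real.exp (p * t) * ‖logTheta q t‖⁻¹ with hf
  have hfi : Integrable f := integrable_exp_mul_inv_norm_logTheta hq p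
  have hgi : Integrable fun x => f (L * x) := hfi.comp_mul_left' hL.ne'
  have hsum := hgi.hasSum_intervalIntegral_comp_add_int
  -- The sum of f over the translates by L is, up to explicit factors, the theta series at Lx - pL
  -- divided by θ at Lx; by the functional equation the quotient is constant in x. The integral over
  -- ℝ is then L times the integral of this constant over one period.
  have hpt : ∀ x : ℝ, HasSum (fun n : ℤ => f (L * (x + n))) (q ^ (p * (p - 1) / 2)) := by
    intro x
    have h1 := (Equiv.hasSum_iff (Equiv.neg ℤ)).2 (hasSum_norm_logTheta hq (L * x - p * L))
    have h2 := norm_logTheta_ofReal_add hq (L * x) (-p)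
    have h3 : L * x + ((-p : ℤ) : ℝ) * Real.log q = L * x - p * L := by push_cast; ring
    have hne := (exists_logTheta_ofReal hq (L * x)).1.ne'
    have h4 := h1.mul_left (f (L * x))
    rw [h3] at h2
    rw [h2] at h4
    have h5 : f (L * x) * (Real.exp (((-p : ℤ) : ℝ) * (L * x) + Real.log q * (((-p : ℤ) : ℝ) *
        (((-p : ℤ) : ℝ) + 1) / 2)) * ‖logTheta q ((L * x : ℝ) : ℂ)‖) = q ^ (p * (p - 1) / 2) := by
      rw [pow_mul_pred_div_two hq, hf]
      simp only
      rw [mul_mul_mul_comm, inv_mul_cancel₀ hne, mul_one, ← Real.exp_add]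
      congr 1; push_cast; ring
    rw [h5] at h4
    refine h4.congr_fun fun n => ?_
    have h6 := norm_logTheta_ofReal_add hq (L * x) n
    have h7 : L * x + n * Real.log q = L * (x + n) := by rw [← hLdef]; ring
    rw [h7] at h6
    simp only [hf, h6, Function.comp, Equiv.neg_apply]
    rw [mul_inv, ← Real.exp_neg, ← mul_assoc, ← Real.exp_add, mul_right_comm, ← Real.exp_add]
    congr 2; push_cast; ring
  have hint : ∀ n : ℤ, Integrable (fun x => f (L * (x + n))) (volume.restrict (Ioc 0 1)) :=
    fun n => (hgi.comp_add_right (n : ℝ)).restrict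
  have hnn : ∀ t, 0 ≤ f t := fun t => by positivity
  simp only [intervalIntegral.integral_of_le zero_le_one] at hsum
  have hswap := hasSum_integral_of_summable_integral_norm hint (by
    simpa only [Real.norm_of_nonneg (hnn _)] using hsum.summable)
  have h := hsum.unique hswap
  simp only [(hpt _).tsum_eq] at h
  rw [Measure.integral_comp_mul_left f L, abs_of_pos (inv_pos.2 hL)] at h
  simp only [integral_const, smul_eq_mul, measureReal_restrict_apply_univ, Real.volume_real_Ioc] at h
  field_simp at h
  rw [h]; simp

end QGevrey

end

noncomputable section

open Complex Filter Topology MeasureTheory Set PowerSeries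

namespace QGevrey

variable {q : ℝ}

/-! ### The formal Borel transform -/

/-- The formal `q`-Borel transform. -/
def formalBorel (q : ℝ) : ℂ⟦X⟧ →ₗ[ℂ] ℂ⟦X⟧ where
  toFun y := PowerSeries.mk (borelCoeff q y)
  map_add' y₁ y₂ := by ext n; simp [borelCoeff, add_div]
  map_smul' c y := by ext n; simp [borelCoeff, mul_div_assoc]

lemma coeff_formalBorel (y : ℂ⟦X⟧) (n : ℕ) : coeff n (formalBorel q y) = borelCoeff q y n := by
  simp [formalBorel]

lemma ofReal_ne_zero_of_one_lt (hq : 1 < q) : (q : ℂ) ≠ 0 := by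
  exact_mod_cast (by linarith : q ≠ 0)

lemma succ_mul_div_two (n : ℕ) : (n + 1) * (n + 1 - 1) / 2 = n * (n - 1) / 2 + n := by
  rw [← Nat.choose_two_right, ← Nat.choose_two_right, Nat.choose_succ_succ' n 1]
  simp; ring

/-- The factor q^n produced by σ_q is exactly the increment of the exponent from n(n-1)/2 to
(n+1)n/2. -/
lemma formalBorel_formalZSigma (hq : 1 < q) (y : ℂ⟦X⟧) :
    formalBorel q (formalZSigma q y) = X * formalBorel q y := by
  have hq0 := ofReal_ne_zero_of_one_lt hq
  ext n
  rcases n with _ | n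
  · simp [coeff_formalBorel, borelCoeff, formalZSigma]
  · rw [coeff_succ_X_mul, coeff_formalBorel, coeff_formalBorel, borelCoeff, borelCoeff,
      succ_mul_div_two, pow_add]
    simp only [formalZSigma, LinearMap.coe_mk, AddHom.coe_mk, coeff_succ_X_mul, coeff_rescale]
    field_simp

lemma formalBorel_injective (hq : 1 < q) : Function.Injective (formalBorel q) := by
  intro y₁ y₂ h
  ext n
  have := congrArg (coeff n) h
  rw [coeff_formalBorel, coeff_formalBorel, borelCoeff, borelCoeff] at this
  exact (div_left_inj' (pow_ne_zero _ (ofReal_ne_zero_of_one_lt hq))).1 this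

/-- The Borel transform turns `P(z σ_q)` into multiplication by `P`. -/
lemma formalBorel_formalOp (hq : 1 < q) (P : Polynomial ℂ) (y : ℂ⟦X⟧) :
    formalBorel q (formalOp q P y) = (P : ℂ⟦X⟧) * formalBorel q y := by
  unfold formalOp
  induction P using Polynomial.induction_on with
  | C a =>
    rw [Polynomial.aeval_C, Module.algebraMap_end_apply, map_smul, Polynomial.coe_C,
      PowerSeries.smul_eq_C_mul]
  | add P Q hP hQ => simp [hP, hQ, add_mul]
  | monomial n a h =>
    rw [pow_succ', mul_left_comm, map_mul, Polynomial.aeval_X, Module.End.mul_apply,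
      formalBorel_formalZSigma hq, h, Polynomial.coe_mul Polynomial.X, Polynomial.coe_X, mul_assoc]

lemma formalOp_injective (hq : 1 < q) {P : Polynomial ℂ} (hP : P ≠ 0) :
    Function.Injective (formalOp q P) := by
  intro y₁ y₂ h
  have h1 := congrArg (formalBorel q) h
  rw [formalBorel_formalOp hq, formalBorel_formalOp hq] at h1
  exact formalBorel_injective hq (mul_left_cancel₀ (by simpa using hP) h1)

lemma isTheFormalSolution_iff (hq : 1 < q) {P : Polynomial ℂ} (hP : P ≠ 0) {g f : ℂ⟦X⟧} :
    IsTheFormalSolution q P g f ↔ formalOp q P f = g :=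
  ⟨fun h => (h f).2 rfl, fun h _ => ⟨fun hy => formalOp_injective hq hP (hy.trans h.symm),
    fun hy => hy ▸ h⟩⟩

lemma hPoly_eval_zero (r : ℕ) (a : ℕ → ℂ) : (hPoly r a).eval 0 = 1 := by
  simp only [hPoly, Polynomial.eval_sub, Polynomial.eval_one, Polynomial.eval_finsetSum,
    Polynomial.eval_mul, Polynomial.eval_C, Polynomial.eval_pow, Polynomial.eval_X]
  rw [Finset.sum_eq_zero, sub_zero]
  intro i hi
  rw [zero_pow (by have := Finset.mem_Icc.1 hi; omega), mul_zero]

lemma ne_zero_of_eval_zero {P : Polynomial ℂ} (h : P.eval 0 ≠ 0) : P ≠ 0 := by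
  rintro rfl; simp at h

lemma hPoly_ne_zero (r : ℕ) (a : ℕ → ℂ) : hPoly r a ≠ 0 :=
  ne_zero_of_eval_zero (by rw [hPoly_eval_zero]; exact one_ne_zero)

lemma coeff_hPoly_mul (r : ℕ) (a : ℕ → ℂ) (B : ℂ⟦X⟧) {j : ℕ} (hj : r < j) :
    coeff j ((hPoly r a : ℂ⟦X⟧) * B) =
      coeff j B - ∑ k ∈ Finset.Ico (j - r) j, a (j - k) * coeff k B := by
  have h1 : (hPoly r a : ℂ⟦X⟧) = 1 - ∑ i ∈ Finset.Icc 1 r, C (a i) * X ^ i := by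
    have := map_sum (Polynomial.coeToPowerSeries.ringHom (R := ℂ))
      (fun i => Polynomial.C (a i) * Polynomial.X ^ i) (Finset.Icc 1 r)
    simp only [Polynomial.coeToPowerSeries.ringHom_apply, Polynomial.coe_mul, Polynomial.coe_C,
      Polynomial.coe_pow, Polynomial.coe_X] at this
    rw [hPoly, Polynomial.coe_sub, Polynomial.coe_one, this]
  rw [h1, sub_mul, one_mul, map_sub, Finset.sum_mul, map_sum]
  congr 1
  refine Finset.sum_nbij' (fun i => j - i) (fun k => j - k) ?_ ?_ ?_ ?_ ?_
  · intro i hi; simp only [Finset.mem_Icc, Finset.mem_Ico] at *; omega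
  · intro i hi; simp only [Finset.mem_Icc, Finset.mem_Ico] at *; omega
  · intro i hi; simp only [Finset.mem_Icc] at *; omega
  · intro i hi; simp only [Finset.mem_Ico] at *; omega
  · intro i hi
    have hi' := Finset.mem_Icc.1 hi
    rw [mul_assoc, coeff_C_mul, coeff_X_pow_mul', if_pos (by omega)]
    congr 2; omega

lemma exists_eq_smul_hPoly {P : Polynomial ℂ} (hP : P.eval 0 ≠ 0) :
    ∃ (r : ℕ) (a : ℕ → ℂ), 1 ≤ r ∧ P = Polynomial.C (P.eval 0) * hPoly r a := by
  -- The maximum with 1 keeps the depth positive when P is constant.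
  refine ⟨max 1 P.natDegree, fun i => -P.coeff i / P.eval 0, le_max_left _ _, ?_⟩
  rw [hPoly, mul_sub, Finset.mul_sum, mul_one]
  have h1 : ∀ i, Polynomial.C (P.eval 0) * (Polynomial.C (-P.coeff i / P.eval 0) *
      Polynomial.X ^ i) = -(Polynomial.C (P.coeff i) * Polynomial.X ^ i) := by
    intro i
    rw [← mul_assoc, ← Polynomial.C_mul, mul_div_cancel₀ _ hP, Polynomial.C_neg, neg_mul]
  simp only [h1, Finset.sum_neg_distrib, sub_neg_eq_add]
  conv_lhs => rw [P.as_sum_range_C_mul_X_pow' (n := max 1 P.natDegree + 1) (by omega)]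
  rw [Finset.sum_range_succ', ← Polynomial.coeff_zero_eq_eval_zero, pow_zero, mul_one, add_comm]
  congr 1
  rw [Finset.range_eq_Ico, Finset.sum_Ico_add' (fun i => Polynomial.C (P.coeff i) *
    Polynomial.X ^ i) 0 _ 1]
  rfl

/-! ### Convergent series and the recurrence estimate -/

lemma isConvergent_iff {g : ℂ⟦X⟧} :
    IsConvergent g ↔ ∃ C M : ℝ, 0 < C ∧ 0 < M ∧ ∀ j, ‖coeff j g‖ ≤ C * M ^ j := by
  constructor
  · rintro ⟨ρ, hρ, h⟩
    have hs : 0 ≤ ∑' p, ‖coeff p g‖ * ρ ^ p := tsum_nonneg fun p => by positivity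
    refine ⟨(∑' p, ‖coeff p g‖ * ρ ^ p) + 1, ρ⁻¹, by positivity, by positivity, fun j => ?_⟩
    have h1 : ‖coeff j g‖ * ρ ^ j ≤ ∑' p, ‖coeff p g‖ * ρ ^ p :=
      h.le_tsum j fun i _ => by positivity
    rw [inv_pow, ← div_eq_mul_inv, le_div_iff₀ (by positivity)]
    linarith
  · rintro ⟨C, M, hC, hM, h⟩
    refine ⟨(2 * M)⁻¹, by positivity, ?_⟩
    refine Summable.of_nonneg_of_le (fun p => by positivity) (fun p => ?_)
      ((summable_geometric_of_lt_one (r := (1 / 2 : ℝ)) (by norm_num) (by norm_num)).mul_left C)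
    calc ‖coeff p g‖ * (2 * M)⁻¹ ^ p ≤ C * M ^ p * (2 * M)⁻¹ ^ p := by gcongr; exact h p
      _ = C * (1 / 2) ^ p := by
        rw [mul_assoc, ← mul_pow]; congr 2; field_simp

lemma norm_borelCoeff (hq : 1 < q) (f : ℂ⟦X⟧) (j : ℕ) :
    ‖borelCoeff q f j‖ = ‖coeff j f‖ / q ^ (j * (j - 1) / 2) := by
  rw [borelCoeff, norm_div, norm_pow, Complex.norm_real, Real.norm_of_nonneg (by linarith)]

lemma recurrence_eq_borelCoeff (hq : 1 < q) (f : ℂ⟦X⟧) (r : ℕ) (a : ℕ → ℂ) {j : ℕ} (hj : r < j) :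
    coeff j f / (q : ℂ) ^ (j * (j - 1) / 2)
        - ∑ k ∈ Finset.Ico (j - r) j, a (j - k) * (coeff k f / (q : ℂ) ^ (k * (k - 1) / 2)) =
      borelCoeff q (formalOp q (hPoly r a) f) j := by
  rw [← coeff_formalBorel, formalBorel_formalOp hq, coeff_hPoly_mul r a _ hj]
  simp only [coeff_formalBorel, borelCoeff]

/-- The recurrence estimate says that `h(z σ_q) f` converges. -/
lemma recurrenceEstimate_iff (hq : 1 < q) (f : ℂ⟦X⟧) (r : ℕ) (a : ℕ → ℂ) :
    RecurrenceEstimate q f r a ↔ IsConvergent (formalOp q (hPoly r a) f) := by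
  have hq0 : 0 < q := by linarith
  rw [isConvergent_iff]
  constructor
  · rintro ⟨C, M, hC, hM, h⟩
    set g := formalOp q (hPoly r a) f
    have hs : ∀ j ∈ Finset.range (r + 1), ‖coeff j g‖ / M ^ j ≤
        ∑ j ∈ Finset.range (r + 1), ‖coeff j g‖ / M ^ j := fun j hj =>
      Finset.single_le_sum (f := fun j => ‖coeff j g‖ / M ^ j) (fun i _ => by positivity) hj
    have hs0 : 0 ≤ ∑ j ∈ Finset.range (r + 1), ‖coeff j g‖ / M ^ j :=
      Finset.sum_nonneg fun i _ => by positivity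
    -- The estimate says nothing about j ≤ r; these finitely many coefficients are absorbed into the
    -- constant.
    refine ⟨C + ∑ j ∈ Finset.range (r + 1), ‖coeff j g‖ / M ^ j, M, by positivity, hM,
      fun j => ?_⟩
    rcases le_or_gt j r with hj | hj
    · rw [← div_le_iff₀ (by positivity)]
      linarith [hs j (Finset.mem_range.2 (by omega))]
    · have h1 := h j hj
      rw [recurrence_eq_borelCoeff hq f r a hj, norm_borelCoeff hq,
        div_le_div_iff_of_pos_right (by positivity)] at h1
      exact h1.trans (by gcongr; linarith)
  · rintro ⟨C, M, hC, hM, h⟩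
    refine ⟨C, M, hC, hM, fun j hj => ?_⟩
    rw [recurrence_eq_borelCoeff hq f r a hj, norm_borelCoeff hq]
    gcongr
    exact h j

lemma formalOp_C_mul (P : Polynomial ℂ) (c : ℂ) (f : ℂ⟦X⟧) :
    formalOp q (Polynomial.C c * P) f = c • formalOp q P f := by
  simp [formalOp, Module.algebraMap_end_apply]

lemma isConvergent_smul {g : ℂ⟦X⟧} (c : ℂ) (hg : IsConvergent g) : IsConvergent (c • g) := by
  obtain ⟨ρ, hρ, h⟩ := hg
  refine ⟨ρ, hρ, ?_⟩
  unfold ConvergesAt at *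
  simpa [mul_assoc] using h.mul_left ‖c‖

lemma exists_recurrenceEstimate_iff (hq : 1 < q) (f : ℂ⟦X⟧) :
    (∃ (P : Polynomial ℂ) (g : ℂ⟦X⟧), P.eval 0 ≠ 0 ∧ IsConvergent g ∧
        IsTheFormalSolution q P g f) ↔
      ∃ (r : ℕ) (a : ℕ → ℂ), 1 ≤ r ∧ RecurrenceEstimate q f r a := by
  constructor
  · rintro ⟨P, g, hP, hg, hsol⟩
    rw [isTheFormalSolution_iff hq (ne_zero_of_eval_zero hP)] at hsol
    obtain ⟨r, a, hr, hPa⟩ := exists_eq_smul_hPoly hP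
    refine ⟨r, a, hr, (recurrenceEstimate_iff hq f r a).2 ?_⟩
    rw [hPa, formalOp_C_mul] at hsol
    rw [eq_inv_smul_iff₀ hP |>.2 hsol]
    exact isConvergent_smul _ hg
  · rintro ⟨r, a, hr, h⟩
    refine ⟨hPoly r a, formalOp q (hPoly r a) f, ?_, (recurrenceEstimate_iff hq f r a).1 h,
      (isTheFormalSolution_iff hq (hPoly_ne_zero r a)).2 rfl⟩
    rw [hPoly_eval_zero]; exact one_ne_zero

/-- The recurrence estimate implies a geometric bound for the Borel transform. -/
lemma RecurrenceEstimate.exists_norm_borelCoeff_le (hq : 1 < q) {f : ℂ⟦X⟧} {r : ℕ} {a : ℕ → ℂ}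
    (h : RecurrenceEstimate q f r a) :
    ∃ C A : ℝ, 0 < C ∧ 0 < A ∧ ∀ p, ‖borelCoeff q f p‖ ≤ C * A ^ p := by
  obtain ⟨C, M, hC, hM, h⟩ := h
  set S : ℝ := ∑ i ∈ Finset.range (r + 1), ‖a i‖ with hS
  have hS0 : 0 ≤ S := Finset.sum_nonneg fun i _ => norm_nonneg _
  -- A ≥ 2S makes the recurrence contribute at most half of the claimed bound, and A ≥ M controls
  -- the error. The constant 2C + T then closes the induction, since C + (2C + T)/2 ≤ 2C + T, with T
  -- covering the initial terms.
  set A : ℝ := 2 * S + M + 1 with hA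
  have hA1 : 1 ≤ A := by linarith
  set T : ℝ := ∑ i ∈ Finset.range (r + 1), ‖borelCoeff q f i‖ with hT
  have hT0 : 0 ≤ T := Finset.sum_nonneg fun i _ => norm_nonneg _
  refine ⟨2 * C + T, A, by positivity, by positivity, fun p => ?_⟩
  induction p using Nat.strong_induction_on with
  | _ j ih =>
    rcases le_or_gt j r with hj | hj
    · have h1 : ‖borelCoeff q f j‖ ≤ T :=
        Finset.single_le_sum (f := fun i => ‖borelCoeff q f i‖) (fun i _ => norm_nonneg _)
          (Finset.mem_range.2 (by omega))
      calc ‖borelCoeff q f j‖ ≤ (2 * C + T) * 1 := by linarith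
        _ ≤ _ := by gcongr; exact one_le_pow₀ hA1
    · have h1 := h j hj
      have h2 : C * M ^ j / q ^ (j * (j - 1) / 2) ≤ C * A ^ j := by
        calc _ ≤ C * M ^ j := div_le_self (by positivity) (one_le_pow₀ hq.le)
          _ ≤ _ := by gcongr; linarith
      have h3 : ‖∑ k ∈ Finset.Ico (j - r) j, a (j - k) * borelCoeff q f k‖ ≤
          S * ((2 * C + T) * A ^ (j - 1)) := by
        calc _ ≤ ∑ k ∈ Finset.Ico (j - r) j, ‖a (j - k)‖ * ((2 * C + T) * A ^ (j - 1)) := by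
              refine norm_sum_le_of_le _ fun k hk => ?_
              have hk' := Finset.mem_Ico.1 hk
              rw [norm_mul]
              gcongr
              refine (ih k hk'.2).trans ?_
              gcongr
              omega
          _ = (∑ k ∈ Finset.Ico (j - r) j, ‖a (j - k)‖) * ((2 * C + T) * A ^ (j - 1)) := by
              rw [Finset.sum_mul]
          _ ≤ _ := by
              gcongr
              rw [hS, ← Finset.sum_image (f := fun i => ‖a i‖) (s := Finset.Ico (j - r) j)
                (g := fun k => j - k)]
              · refine Finset.sum_le_sum_of_subset_of_nonneg ?_ fun _ _ _ => norm_nonneg _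
                intro i hi
                obtain ⟨k, hk, rfl⟩ := Finset.mem_image.1 hi
                have hk' := Finset.mem_Ico.1 hk
                exact Finset.mem_range.2 (by omega)
              · intro x hx y hy hxy
                have hx' := Finset.mem_Ico.1 (Finset.mem_coe.1 hx)
                have hy' := Finset.mem_Ico.1 (Finset.mem_coe.1 hy)
                simp only at hxy
                omega
      have h4 : A ^ j = A * A ^ (j - 1) := by
        rw [← pow_succ']; congr 1; omega
      have h5 : borelCoeff q f j = (borelCoeff q f j -
          ∑ k ∈ Finset.Ico (j - r) j, a (j - k) * borelCoeff q f k) +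
          ∑ k ∈ Finset.Ico (j - r) j, a (j - k) * borelCoeff q f k := by ring
      have h6 : 0 < A ^ (j - 1) := by positivity
      rw [h5]
      refine (norm_add_le _ _).trans ((add_le_add (h1.trans h2) h3).trans ?_)
      rw [h4]
      have h7 : 2 * S ≤ A := by linarith
      have h8 : 0 ≤ (2 * C + T) * A ^ (j - 1) := by positivity
      nlinarith [mul_le_mul_of_nonneg_right h7 h8, mul_nonneg hT0 (mul_pos (by linarith : 0 < A) h6).le]

lemma isQGevrey_of_borelCoeff (hq : 1 < q) {f : ℂ⟦X⟧}
    (h : ∃ C A : ℝ, 0 < C ∧ 0 < A ∧ ∀ p, ‖borelCoeff q f p‖ ≤ C * A ^ p) : IsQGevrey q f := by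
  obtain ⟨C, A, hC, hA, h⟩ := h
  refine ⟨C, A, hC, hA, fun p => ?_⟩
  have := h p
  rwa [norm_borelCoeff hq, div_le_iff₀ (by positivity)] at this

/-! ### Evaluation of series and operators -/

lemma hasSum_coeff_polynomial_mul {S : ℂ⟦X⟧} {z s : ℂ}
    (h : HasSum (fun n => coeff n S * z ^ n) s) (P : Polynomial ℂ) :
    HasSum (fun n => coeff n ((P : ℂ⟦X⟧) * S) * z ^ n) (P.eval z * s) := by
  induction P using Polynomial.induction_on with
  | C a => simpa [mul_assoc] using h.mul_left a
  | add P Q hP hQ => simpa [add_mul] using hP.add hQ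
  | monomial n a ih =>
    rw [pow_succ', mul_left_comm, Polynomial.coe_mul, Polynomial.coe_X, mul_assoc,
      Polynomial.eval_mul, Polynomial.eval_X, mul_assoc]
    rw [← hasSum_nat_add_iff' 1]
    simp only [coeff_succ_X_mul, Finset.range_one, Finset.sum_singleton, coeff_zero_X_mul, zero_mul,
      sub_zero, pow_succ]
    simpa only [mul_assoc, mul_comm z] using ih.mul_right z

lemma zSigma_pow_apply (k : ℕ) (F : ℂ → ℂ) (w : ℂ) :
    (zSigma q ^ k) F w =
      exp (k * w + Real.log q * (k * (k - 1) / 2)) * F (w + k * Real.log q) := by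
  induction k generalizing w with
  | zero => simp
  | succ k ih =>
    rw [pow_succ', Module.End.mul_apply]
    simp only [zSigma, LinearMap.coe_mk, AddHom.coe_mk] at ih ⊢
    rw [ih, ← mul_assoc, ← Complex.exp_add]
    congr 2
    · push_cast; ring
    · push_cast; ring

lemma functionOp_apply (P : Polynomial ℂ) (F : ℂ → ℂ) (w : ℂ) :
    functionOp q P F w = ∑ k ∈ Finset.range (P.natDegree + 1),
      P.coeff k * (exp (k * w + Real.log q * (k * (k - 1) / 2)) * F (w + k * Real.log q)) := by
  rw [functionOp, Polynomial.aeval_eq_sum_range, LinearMap.sum_apply, Finset.sum_apply]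
  refine Finset.sum_congr rfl fun k _ => ?_
  rw [LinearMap.smul_apply, Pi.smul_apply, smul_eq_mul, zSigma_pow_apply]

end QGevrey

end

noncomputable section

open Complex Filter Topology MeasureTheory Set

namespace QGevrey

variable {q : ℝ}

/-! ### Growth bounds -/

/-- The growth allowed for Borel transforms, as a function of `log |ξ|`. -/
def growth (q κ s : ℝ) : ℝ := Real.exp (max s 0 ^ 2 / (2 * Real.log q) + κ * max s 0)

lemma growth_pos (q κ s : ℝ) : 0 < growth q κ s := Real.exp_pos _

lemma growth_mono (hq : 1 < q) {κ s t : ℝ} (hκ : 0 ≤ κ) (h : s ≤ t) :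
    growth q κ s ≤ growth q κ t := by
  have := log_pos_of_one_lt hq
  unfold growth
  gcongr

lemma one_le_growth (hq : 1 < q) {κ : ℝ} (hκ : 0 ≤ κ) (s : ℝ) : 1 ≤ growth q κ s := by
  have := log_pos_of_one_lt hq
  exact Real.one_le_exp (by positivity)

/-- Completing the square, then giving away most of the Gaussian for (1 + s²)⁻¹, the common
integrable majorant of all later integrands. -/
lemma exp_quadratic_le {b : ℝ} (hb : 0 < b) (c s : ℝ) :
    Real.exp (-b * s ^ 2 + c * s) ≤ Real.exp (c ^ 2 / (2 * b)) * (1 + 2 / b) * (1 + s ^ 2)⁻¹ := by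
  have h1 : -b * s ^ 2 + c * s ≤ c ^ 2 / (2 * b) + -(b / 2 * s ^ 2) := by
    have : 0 ≤ (b * s - c) ^ 2 / (2 * b) := by positivity
    have h2 : (b * s - c) ^ 2 / (2 * b) = b / 2 * s ^ 2 - c * s + c ^ 2 / (2 * b) := by
      field_simp; ring
    linarith
  have h3 : Real.exp (-(b / 2 * s ^ 2)) ≤ (1 + 2 / b) * (1 + s ^ 2)⁻¹ := by
    rw [Real.exp_neg, ← div_eq_mul_inv, inv_eq_one_div, div_le_div_iff₀ (Real.exp_pos _) (by positivity)]
    have h4 := Real.add_one_le_exp (b / 2 * s ^ 2)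
    calc 1 * (1 + s ^ 2) ≤ (1 + 2 / b) * (b / 2 * s ^ 2 + 1) := by
          have : (1 + 2 / b) * (b / 2 * s ^ 2 + 1) = b / 2 * s ^ 2 + 1 + s ^ 2 + 2 / b := by
            field_simp
            ring
          rw [this]
          have : 0 ≤ b / 2 * s ^ 2 := by positivity
          have : 0 ≤ 2 / b := by positivity
          linarith
      _ ≤ _ := by gcongr
  calc _ ≤ Real.exp (c ^ 2 / (2 * b) + -(b / 2 * s ^ 2)) := Real.exp_le_exp.2 h1
    _ ≤ _ := by rw [Real.exp_add, mul_assoc]; gcongr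

/-- The product of an admissible growth and a translated Gaussian kernel is integrable, locally
uniformly in the translation. -/
lemma exists_growth_mul_kernel_le (hq : 1 < q) (κ x₁ : ℝ) :
    ∃ K : ℝ, 0 < K ∧ ∀ x s : ℝ, x₁ ≤ x → x ≤ -(Real.log q * (κ + 1)) →
      growth q κ s * Real.exp (-((s - x) ^ 2 / (2 * Real.log q) + (s - x) / 2)) ≤
        K * (1 + s ^ 2)⁻¹ := by
  have hL := log_pos_of_one_lt hq
  set L := Real.log q with hLdef
  set b := 1 / (2 * L) with hb
  set c := x₁ / L - 1 / 2 with hc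
  have hb0 : 0 < b := by positivity
  refine ⟨Real.exp (L / 8) * (2 + Real.exp (c ^ 2 / (2 * b)) * (1 + 2 / b)), by positivity,
    fun x s hx₁ hx => ?_⟩
  rw [growth, ← Real.exp_add, ← hLdef]
  have hx8 : -x ^ 2 / (2 * L) + x / 2 ≤ L / 8 := by
    have : 0 ≤ (x - L / 2) ^ 2 / (2 * L) := by positivity
    have h2 : (x - L / 2) ^ 2 / (2 * L) = x ^ 2 / (2 * L) - x / 2 + L / 8 := by
      field_simp; ring
    have h3 : -x ^ 2 / (2 * L) = -(x ^ 2 / (2 * L)) := by ring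
    linarith
  have hi : 0 < (1 + s ^ 2)⁻¹ := by positivity
  rcases le_total 0 s with hs | hs
  · rw [max_eq_left hs]
    -- For s ≥ 0 the quadratic terms in s cancel and a linear exponent with slope κ + x/L - 1/2
    -- remains. Smallness of |z| makes this slope at most -3/2.
    have h1 : x / L ≤ -(κ + 1) := by rw [div_le_iff₀ hL]; linarith
    have h2 : s ^ 2 / (2 * L) + κ * s + -((s - x) ^ 2 / (2 * L) + (s - x) / 2) ≤ L / 8 + -s := by
      have : s ^ 2 / (2 * L) + κ * s + -((s - x) ^ 2 / (2 * L) + (s - x) / 2) =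
          (-x ^ 2 / (2 * L) + x / 2) + s * (κ + x / L - 1 / 2) := by field_simp; ring
      rw [this]
      nlinarith [mul_le_mul_of_nonneg_left h1 hs]
    have h3 : Real.exp (-s) ≤ 2 * (1 + s ^ 2)⁻¹ := by
      rw [Real.exp_neg, ← div_eq_mul_inv, inv_eq_one_div,
        div_le_div_iff₀ (Real.exp_pos _) (by positivity)]
      nlinarith [Real.quadratic_le_exp_of_nonneg hs]
    calc _ ≤ Real.exp (L / 8 + -s) := Real.exp_le_exp.2 h2
      _ ≤ Real.exp (L / 8) * (2 * (1 + s ^ 2)⁻¹) := by rw [Real.exp_add]; gcongr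
      _ ≤ _ := by
        rw [← mul_assoc]
        gcongr
        have : 0 ≤ Real.exp (c ^ 2 / (2 * b)) * (1 + 2 / b) := by positivity
        linarith
  · rw [max_eq_right hs]
    have h2 : (0 : ℝ) ^ 2 / (2 * L) + κ * 0 + -((s - x) ^ 2 / (2 * L) + (s - x) / 2) ≤
        L / 8 + (-b * s ^ 2 + c * s) := by
      have : (0 : ℝ) ^ 2 / (2 * L) + κ * 0 + -((s - x) ^ 2 / (2 * L) + (s - x) / 2) =
          (-x ^ 2 / (2 * L) + x / 2) + (-b * s ^ 2 + (x / L - 1 / 2) * s) := by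
        rw [hb]; field_simp; ring
      rw [this]
      -- For s ≤ 0 the Gaussian survives; the lower bound x₁ keeps its linear term uniform in x.
      have h4 : x₁ / L ≤ x / L := by gcongr
      have h5 : (x / L - 1 / 2) * s ≤ c * s := mul_le_mul_of_nonpos_right (by linarith) hs
      linarith
    calc _ ≤ Real.exp (L / 8 + (-b * s ^ 2 + c * s)) := Real.exp_le_exp.2 h2
      _ ≤ Real.exp (L / 8) * (Real.exp (c ^ 2 / (2 * b)) * (1 + 2 / b) * (1 + s ^ 2)⁻¹) := by
        rw [Real.exp_add]; gcongr; exact exp_quadratic_le hb0 c s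
      _ ≤ _ := by
        rw [← mul_assoc]
        gcongr
        linarith

/-- Domination of the integrand of the Laplace transform. -/
lemma exists_norm_div_logTheta_le (hq : 1 < q) {b : ℝ} (hb : b < Real.pi) (C κ x₁ : ℝ)
    (hC : 0 < C) :
    ∃ K : ℝ, 0 < K ∧ ∀ (φ u w : ℂ), ‖φ‖ ≤ C * growth q κ u.re → x₁ ≤ w.re →
      w.re ≤ -(Real.log q * (κ + 1)) → |u.im - w.im| ≤ b →
      ‖φ / logTheta q (u - w)‖ ≤ K * (1 + u.re ^ 2)⁻¹ := by
  obtain ⟨K₁, hK₁, h₁⟩ := exists_norm_inv_logTheta_le hq hb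
  obtain ⟨K₂, hK₂, h₂⟩ := exists_growth_mul_kernel_le hq κ x₁
  refine ⟨C * K₁ * K₂, by positivity, fun φ u w hφ hw₁ hw₂ hu => ?_⟩
  have h3 := h₁ (u - w) (by simpa using hu)
  have h4 := h₂ w.re u.re hw₁ hw₂
  rw [div_eq_mul_inv, norm_mul]
  rw [sub_re] at h3
  calc _ ≤ (C * growth q κ u.re) *
      (K₁ * Real.exp (-((u.re - w.re) ^ 2 / (2 * Real.log q) + (u.re - w.re) / 2))) := by
        gcongr
        exact (norm_nonneg _).trans hφ
    _ = C * K₁ * (growth q κ u.re *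
          Real.exp (-((u.re - w.re) ^ 2 / (2 * Real.log q) + (u.re - w.re) / 2))) := by ring
    _ ≤ C * K₁ * (K₂ * (1 + u.re ^ 2)⁻¹) := by gcongr
    _ = _ := by ring

/-! ### Shifting horizontal contours -/

lemma tendsto_inv_one_add_sq : Tendsto (fun T : ℝ => (1 + T ^ 2)⁻¹) atTop (𝓝 0) :=
  tendsto_inv_atTop_zero.comp
    (tendsto_atTop_add_const_left _ _ (tendsto_pow_atTop two_ne_zero))

lemma integrable_horizontal {Ψ : ℂ → ℂ} {K e : ℝ}
    (hd : ∀ u : ℂ, u.im = e → DifferentiableAt ℂ Ψ u)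
    (hb : ∀ u : ℂ, u.im = e → ‖Ψ u‖ ≤ K * (1 + u.re ^ 2)⁻¹) :
    Integrable fun s : ℝ => Ψ (s + e * I) := by
  have hc : Continuous fun s : ℝ => Ψ (s + e * I) := continuous_iff_continuousAt.2 fun s =>
    ContinuousAt.comp' (f := fun s : ℝ => (s + e * I : ℂ)) (hd _ (by simp)).continuousAt
      (by fun_prop)
  refine (integrable_inv_one_add_sq.const_mul K).mono' hc.aestronglyMeasurable
    (Eventually.of_forall fun s => ?_)
  simpa using hb (s + e * I) (by simp)

/-- Horizontal contours can be shifted through a region of holomorphy and decay. -/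
lemma integral_horizontal_eq_of_le {Ψ : ℂ → ℂ} {K e₁ e₂ : ℝ} (he : e₁ ≤ e₂)
    (hd : ∀ u : ℂ, u.im ∈ Icc e₁ e₂ → DifferentiableAt ℂ Ψ u)
    (hb : ∀ u : ℂ, u.im ∈ Icc e₁ e₂ → ‖Ψ u‖ ≤ K * (1 + u.re ^ 2)⁻¹) :
    ∫ s : ℝ, Ψ (s + e₁ * I) = ∫ s : ℝ, Ψ (s + e₂ * I) := by
  have hi : ∀ e ∈ Icc e₁ e₂, Tendsto (fun T : ℝ => ∫ s in (-T)..T, Ψ (s + e * I)) atTop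
      (𝓝 (∫ s : ℝ, Ψ (s + e * I))) := fun e he' =>
    intervalIntegral_tendsto_integral
      (integrable_horizontal (fun u hu => hd u (hu ▸ he')) (fun u hu => hb u (hu ▸ he')))
      tendsto_neg_atTop_atBot tendsto_id
  -- σ T stands for T and -T, so both vertical sides of the rectangle are treated at once.
  have hvert : ∀ σ : ℝ → ℝ, (∀ T, σ T ^ 2 = T ^ 2) →
      Tendsto (fun T : ℝ => I • ∫ y in e₁..e₂, Ψ (σ T + y * I)) atTop (𝓝 0) := by
    intro σ hσ
    have h1 : Tendsto (fun T : ℝ => K * (1 + T ^ 2)⁻¹ * |e₂ - e₁|) atTop (𝓝 0) := by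
      simpa using (tendsto_inv_one_add_sq.const_mul K).mul_const |e₂ - e₁|
    refine squeeze_zero_norm (fun T => ?_) h1
    rw [norm_smul, norm_I, one_mul]
    refine intervalIntegral.norm_integral_le_of_norm_le_const fun y hy => ?_
    rw [uIoc_of_le he] at hy
    have := hb (σ T + y * I) (by simpa using ⟨hy.1.le, hy.2⟩)
    simpa [hσ] using this
  have hrect : ∀ T : ℝ, (∫ s in (-T)..T, Ψ (s + e₁ * I)) - (∫ s in (-T)..T, Ψ (s + e₂ * I)) +
      I • (∫ y in e₁..e₂, Ψ ((T : ℝ) + y * I)) -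
      I • (∫ y in e₁..e₂, Ψ ((-T : ℝ) + y * I)) = 0 := by
    intro T
    have := integral_boundary_rect_eq_zero_of_differentiableOn Ψ (⟨-T, e₁⟩ : ℂ) ⟨T, e₂⟩
      (fun u hu => (hd u (by
        have := hu.2
        rw [uIcc_of_le he] at this
        exact this)).differentiableWithinAt)
    simpa using this
  have hlim := (((hi e₁ ⟨le_rfl, he⟩).sub (hi e₂ ⟨he, le_rfl⟩)).add (hvert id fun T => rfl)).sub
    (hvert (fun T => -T) fun T => by simp)
  simp only [id, hrect] at hlim
  have := tendsto_nhds_unique tendsto_const_nhds hlim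
  rw [add_zero, sub_zero] at this
  exact sub_eq_zero.1 this.symm

lemma integral_horizontal_eq {Ψ : ℂ → ℂ} {K e₁ e₂ : ℝ}
    (hd : ∀ u : ℂ, u.im ∈ uIcc e₁ e₂ → DifferentiableAt ℂ Ψ u)
    (hb : ∀ u : ℂ, u.im ∈ uIcc e₁ e₂ → ‖Ψ u‖ ≤ K * (1 + u.re ^ 2)⁻¹) :
    ∫ s : ℝ, Ψ (s + e₁ * I) = ∫ s : ℝ, Ψ (s + e₂ * I) := by
  rcases le_total e₁ e₂ with he | he
  · rw [uIcc_of_le he] at hd hb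
    exact integral_horizontal_eq_of_le he hd hb
  · rw [uIcc_of_ge he] at hd hb
    exact (integral_horizontal_eq_of_le he hd hb).symm

/-! ### The Laplace transform in the logarithmic chart -/

/-- The Laplace integral in direction `e`, in the logarithmic chart and without normalisation. -/
def logLaplace (q : ℝ) (Φ : ℂ → ℂ) (e : ℝ) (w : ℂ) : ℂ :=
  ∫ s : ℝ, Φ (s + e * I) / logTheta q (s + e * I - w)

lemma exp_smul_laplaceIntegrand (q d : ℝ) (Φ : ℂ → ℂ) (w : ℂ) (t : ℝ) :
    |Real.exp t| • laplaceIntegrand q d Φ w (Real.exp t) =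
      Φ (t + d * I) / logTheta q (t + d * I - w) := by
  rw [laplaceIntegrand, Real.log_exp, logTheta, Complex.exp_sub, Complex.exp_add, ← ofReal_exp,
    abs_of_pos (Real.exp_pos _), Complex.real_smul]
  exact mul_div_cancel₀ _ (by exact_mod_cast (Real.exp_pos t).ne')

lemma integrableOn_laplaceIntegrand_iff (q d : ℝ) (Φ : ℂ → ℂ) (w : ℂ) :
    IntegrableOn (laplaceIntegrand q d Φ w) (Ioi 0) ↔
      Integrable fun s : ℝ => Φ (s + d * I) / logTheta q (s + d * I - w) := by
  rw [← Real.range_exp, ← image_univ, integrableOn_image_iff_integrableOn_abs_deriv_smul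
    MeasurableSet.univ (fun x _ => (Real.hasDerivAt_exp x).hasDerivWithinAt)
    (Real.exp_injective.injOn), integrableOn_univ]
  simp only [exp_smul_laplaceIntegrand]

lemma qLaplace_eq (q d : ℝ) (Φ : ℂ → ℂ) (w : ℂ) :
    qLaplace q d Φ w = 1 / (Real.log q : ℂ) * logLaplace q Φ d w := by
  rw [qLaplace, logLaplace]
  congr 1
  rw [← Real.range_exp, ← image_univ, integral_image_eq_integral_abs_deriv_smul
    MeasurableSet.univ (fun x _ => (Real.hasDerivAt_exp x).hasDerivWithinAt)
    (Real.exp_injective.injOn), setIntegral_univ]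
  simp only [exp_smul_laplaceIntegrand]

/-- A function holomorphic in the strip `S_d(ε)` with admissible growth. -/
structure HasGrowth (q d ε C κ : ℝ) (Φ : ℂ → ℂ) : Prop where
  differentiableOn : DifferentiableOn ℂ Φ (unboundedSector d ε)
  pos : 0 < C
  nonneg : 0 ≤ κ
  norm_le : ∀ w ∈ unboundedSector d ε, ‖Φ w‖ ≤ C * growth q κ w.re

lemma isOpen_unboundedSector (d ε : ℝ) : IsOpen (unboundedSector d ε) :=
  isOpen_lt (by fun_prop) continuous_const

lemma isOpen_sector (d θ r : ℝ) : IsOpen (sector d θ r) :=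
  (isOpen_lt (f := fun w : ℂ => |w.im - d|) (by fun_prop) continuous_const).inter
    (isOpen_lt (f := fun w : ℂ => Real.exp w.re) (by fun_prop) continuous_const)

section Laplace

variable {d ε C κ : ℝ} {Φ : ℂ → ℂ}

lemma HasGrowth.differentiableAt_integrand (hq : 1 < q) (h : HasGrowth q d ε C κ Φ) {u w : ℂ}
    (hu : u ∈ unboundedSector d ε) (hw : |u.im - w.im| < Real.pi) :
    DifferentiableAt ℂ (fun u => Φ u / logTheta q (u - w)) u :=
  (h.differentiableOn.differentiableAt ((isOpen_unboundedSector d ε).mem_nhds hu)).div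
    ((differentiable_logTheta hq _).comp u (by fun_prop))
    (logTheta_ne_zero hq (by simpa using hw))

lemma HasGrowth.integrable (hq : 1 < q) (h : HasGrowth q d ε C κ Φ) {e : ℝ} {w : ℂ}
    (he : |e - d| < Real.pi * ε / 2) (hw : |e - w.im| < Real.pi)
    (hre : w.re ≤ -(Real.log q * (κ + 1))) :
    Integrable fun s : ℝ => Φ (s + e * I) / logTheta q (s + e * I - w) := by
  obtain ⟨K, -, hb⟩ := exists_norm_div_logTheta_le hq hw C κ w.re h.pos
  refine integrable_horizontal (Ψ := fun u => Φ u / logTheta q (u - w)) (K := K)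
    (fun u hu => ?_) (fun u hu => ?_)
  · subst hu; exact h.differentiableAt_integrand hq he hw
  · subst hu; exact hb _ _ _ (h.norm_le _ he) le_rfl hre le_rfl

lemma abs_sub_le_max_of_mem_uIcc {x a b c : ℝ} (h : x ∈ uIcc a b) :
    |x - c| ≤ max |a - c| |b - c| := by
  rcases le_total a b with hab | hab
  · rw [uIcc_of_le hab] at h
    exact abs_le_max_abs_abs (by linarith [h.1]) (by linarith [h.2])
  · rw [uIcc_of_ge hab] at h
    rw [max_comm]
    exact abs_le_max_abs_abs (by linarith [h.1]) (by linarith [h.2])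

/-- The Laplace integral does not depend on the direction. -/
lemma HasGrowth.logLaplace_eq (hq : 1 < q) (h : HasGrowth q d ε C κ Φ) {e₁ e₂ : ℝ} {w : ℂ}
    (he₁ : |e₁ - d| < Real.pi * ε / 2) (he₂ : |e₂ - d| < Real.pi * ε / 2)
    (hw₁ : |e₁ - w.im| < Real.pi) (hw₂ : |e₂ - w.im| < Real.pi)
    (hre : w.re ≤ -(Real.log q * (κ + 1))) :
    logLaplace q Φ e₁ w = logLaplace q Φ e₂ w := by
  obtain ⟨K, -, hb⟩ := exists_norm_div_logTheta_le hq (max_lt hw₁ hw₂) C κ w.re h.pos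
  have hmem : ∀ u : ℂ, u.im ∈ uIcc e₁ e₂ → u ∈ unboundedSector d ε := fun u hu =>
    (abs_sub_le_max_of_mem_uIcc hu).trans_lt (max_lt he₁ he₂)
  refine integral_horizontal_eq (Ψ := fun u => Φ u / logTheta q (u - w)) (K := K)
    (fun u hu => ?_) (fun u hu => ?_)
  · exact h.differentiableAt_integrand hq (hmem u hu)
      ((abs_sub_le_max_of_mem_uIcc hu).trans_lt (max_lt hw₁ hw₂))
  · exact hb _ _ _ (h.norm_le _ (hmem u hu)) le_rfl hre (abs_sub_le_max_of_mem_uIcc hu)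

/-- The Laplace integral is holomorphic. -/
lemma HasGrowth.differentiableAt_logLaplace (hq : 1 < q) (h : HasGrowth q d ε C κ Φ) {e : ℝ}
    {w₀ : ℂ} (he : |e - d| < Real.pi * ε / 2) (hw : |e - w₀.im| < Real.pi)
    (hre : w₀.re < -(Real.log q * (κ + 1))) :
    DifferentiableAt ℂ (logLaplace q Φ e) w₀ := by
  obtain ⟨b, hb₁, hb₂⟩ := exists_between hw
  -- The radius 2r leaves room for circles of radius r around every point of the ball of radius r
  -- about w₀.
  obtain ⟨r, hr0, hr⟩ : ∃ r : ℝ, 0 < r ∧ ∀ w : ℂ, ‖w - w₀‖ ≤ 2 * r →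
      |e - w.im| ≤ b ∧ w.re ≤ -(Real.log q * (κ + 1)) := by
    set m := min (b - |e - w₀.im|) (-(Real.log q * (κ + 1)) - w₀.re)
    have hm : 0 < m := lt_min (by linarith) (by linarith)
    refine ⟨m / 2, by positivity, fun w hw => ?_⟩
    have h1 := (abs_re_le_norm (w - w₀)).trans hw
    have h2 := (abs_im_le_norm (w - w₀)).trans hw
    rw [sub_re] at h1
    rw [sub_im] at h2
    have h3 : m ≤ b - |e - w₀.im| := min_le_left _ _
    have h4 : m ≤ -(Real.log q * (κ + 1)) - w₀.re := min_le_right _ _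
    constructor
    · have : |e - w.im| ≤ |e - w₀.im| + |w₀.im - w.im| := abs_sub_le _ _ _
      rw [abs_sub_comm] at h2
      linarith
    · have := (abs_le.1 h1).2
      linarith
  obtain ⟨K, hK, hbd⟩ := exists_norm_div_logTheta_le hq hb₂ C κ (w₀.re - 2 * r) h.pos
  have hΦc : Continuous fun s : ℝ => Φ (s + e * I) := continuous_iff_continuousAt.2 fun s =>
    ContinuousAt.comp' (f := fun s : ℝ => (s + e * I : ℂ))
      (h.differentiableOn.differentiableAt ((isOpen_unboundedSector d ε).mem_nhds
        (by simpa [unboundedSector] using he))).continuousAt (by fun_prop)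
  have hΘ := differentiable_logTheta hq
  have hΘ' : Continuous (deriv (logTheta q)) := (hΘ.contDiff (n := 1)).continuous_deriv le_rfl
  have hne : ∀ w : ℂ, ‖w - w₀‖ ≤ 2 * r → ∀ s : ℝ, logTheta q (s + e * I - w) ≠ 0 := fun w hw s =>
    logTheta_ne_zero hq (by simpa using (hr w hw).1.trans_lt hb₂)
  have hFc : ∀ w : ℂ, ‖w - w₀‖ ≤ 2 * r →
      Continuous fun s : ℝ => Φ (s + e * I) / logTheta q (s + e * I - w) := fun w hw =>
    hΦc.div (hΘ.continuous.comp (by fun_prop)) (hne w hw)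
  have hbound : ∀ w : ℂ, ‖w - w₀‖ ≤ 2 * r → ∀ s : ℝ,
      ‖Φ (s + e * I) / logTheta q (s + e * I - w)‖ ≤ K * (1 + s ^ 2)⁻¹ := by
    intro w hw s
    have h1 := hbd (Φ (s + e * I)) (s + e * I) w
      (h.norm_le _ (by simpa [unboundedSector] using he))
      (by
        have := (abs_re_le_norm (w - w₀)).trans hw
        rw [sub_re] at this
        linarith [(abs_le.1 this).1])
      (hr w hw).2 (by simpa using (hr w hw).1)
    simpa using h1
  set F' : ℂ → ℝ → ℂ := fun w s => Φ (s + e * I) *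
    (deriv (logTheta q) (s + e * I - w) / logTheta q (s + e * I - w) ^ 2) with hF'
  have hderiv : ∀ w : ℂ, ‖w - w₀‖ ≤ 2 * r → ∀ s : ℝ,
      HasDerivAt (fun w => Φ (s + e * I) / logTheta q (s + e * I - w)) (F' w s) w := by
    intro w hw s
    have h1 : HasDerivAt (fun w => logTheta q (s + e * I - w))
        (-deriv (logTheta q) (s + e * I - w)) w := by
      simpa [Function.comp_def] using
        HasDerivAt.comp w (hΘ _).hasDerivAt ((hasDerivAt_id w).const_sub (s + e * I))
    have h2 := (h1.inv (hne w hw s)).const_mul (Φ (s + e * I))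
    simpa [div_eq_mul_inv, hF'] using h2
  refine (hasDerivAt_integral_of_dominated_loc_of_deriv_le (F' := F')
    (bound := fun s => K * (1 + s ^ 2)⁻¹ / r) (Metric.ball_mem_nhds w₀ hr0) ?_ ?_ ?_ ?_ ?_ ?_).2
    |>.differentiableAt
  · filter_upwards [Metric.ball_mem_nhds w₀ hr0] with w hw
    refine (hFc w ?_).aestronglyMeasurable
    have := mem_ball_iff_norm.1 hw
    linarith
  · exact h.integrable hq he hw hre.le
  · have h0 : ‖w₀ - w₀‖ ≤ 2 * r := by simpa using hr0.le
    refine (hΦc.mul ((hΘ'.comp (by fun_prop)).div ((hΘ.continuous.comp (by fun_prop)).pow 2)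
      fun s => pow_ne_zero _ (hne w₀ h0 s))).aestronglyMeasurable
  -- Cauchy's estimate on a circle of radius r transfers the majorant from the integrand to its
  -- w-derivative, so no bound on θ' is needed.
  · refine Eventually.of_forall fun s w hw => ?_
    have hw' := mem_ball_iff_norm.1 hw
    rw [← (hderiv w (by linarith) s).deriv]
    have hsub : ∀ z ∈ Metric.closedBall w r, ‖z - w₀‖ ≤ 2 * r := fun z hz => by
      have h1 := mem_closedBall_iff_norm.1 hz
      have h2 := norm_add_le (z - w) (w - w₀)
      rw [sub_add_sub_cancel] at h2
      linarith
    refine norm_deriv_le_of_forall_mem_sphere_norm_le hr0 ?_ fun z hz =>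
      hbound z (hsub z (Metric.sphere_subset_closedBall hz)) s
    refine DifferentiableOn.diffContOnCl fun z hz => ?_
    rw [closure_ball w hr0.ne'] at hz
    exact (hderiv z (hsub z hz) s).differentiableAt.differentiableWithinAt
  · exact (integrable_inv_one_add_sq.const_mul K).div_const r
  · refine Eventually.of_forall fun s w hw => hderiv w ?_ s
    have := mem_ball_iff_norm.1 hw
    linarith

end Laplace

end QGevrey

end

noncomputable section

open Complex Filter Topology MeasureTheory Set PowerSeries

namespace QGevrey

variable {q : ℝ}

/-! ### Growth of Borel transforms -/

lemma norm_exp_add_exp_quadratic_le (hq : 1 < q) (μ : ℝ) (w : ℂ) :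
    ‖exp (μ * w) * exp (w ^ 2 / (2 * Real.log q))‖ ≤
      Real.exp (|w.re| ^ 2 / (2 * Real.log q) + |μ| * |w.re|) := by
  have hL := log_pos_of_one_lt hq
  rw [← Complex.exp_add, Complex.norm_exp, Real.exp_le_exp, add_re, re_ofReal_mul]
  have h1 : (w ^ 2 / (2 * Real.log q) : ℂ) = w ^ 2 / ((2 * Real.log q : ℝ) : ℂ) := by push_cast; rfl
  rw [h1, div_ofReal_re, sq w, mul_re, sq_abs]
  have h2 : (w.re * w.re - w.im * w.im) / (2 * Real.log q) ≤ w.re ^ 2 / (2 * Real.log q) := by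
    gcongr
    nlinarith [mul_self_nonneg w.im]
  have h3 : μ * w.re ≤ |μ| * |w.re| := by rw [← abs_mul]; exact le_abs_self _
  linarith

/-- The analytic continuation of the Borel transform has admissible growth. -/
lemma IsBorelContinuation.exists_hasGrowth (hq : 1 < q) {f : ℂ⟦X⟧} {d ε : ℝ} {Φ : ℂ → ℂ}
    (hε : 0 < ε) (h : IsBorelContinuation q f d ε Φ) : ∃ C κ, HasGrowth q d ε C κ Φ := by
  have hL := log_pos_of_one_lt hq
  obtain ⟨hd, ⟨ρ, hρ, hs⟩, C, μ, hC, hg⟩ := h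
  set x₁ := Real.log (ρ / 2)
  have hx₁ : Real.exp x₁ = ρ / 2 := Real.exp_log (by positivity)
  have hsum : Summable fun p : ℕ => ‖borelCoeff q f p‖ * (ρ / 2) ^ p := by
    have h1 := (hs (x₁ + d * I) ⟨by simp; positivity, by simp [hx₁]; linarith⟩).summable.norm
    refine h1.congr fun p => ?_
    rw [norm_mul, norm_pow, Complex.norm_exp]
    simp [hx₁]
  set S := ∑' p : ℕ, ‖borelCoeff q f p‖ * (ρ / 2) ^ p with hS
  have hS0 : 0 ≤ S := tsum_nonneg fun p => by positivity
  set D := C * Real.exp (|x₁| ^ 2 / (2 * Real.log q) + |μ| * |x₁|) with hD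
  refine ⟨S + D + C, |μ|, hd, by positivity, abs_nonneg _, fun w hw => ?_⟩
  have hg1 := one_le_growth hq (abs_nonneg μ) w.re
  have hwg := (hg w hw).trans (mul_le_mul_of_nonneg_left (norm_exp_add_exp_quadratic_le hq μ w) hC.le)
  rcases le_total 0 w.re with h0 | h0
  · calc ‖Φ w‖ ≤ C * growth q |μ| w.re := by
          rw [growth, max_eq_left h0]; rwa [abs_of_nonneg h0] at hwg
      _ ≤ _ := by gcongr; linarith [show 0 ≤ D by positivity]
  -- The assumed bound blows up as Re w → -∞. It is used down to x₁, and further left the convergent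
  -- power series bounds Φ.
  rcases le_total x₁ w.re with h1 | h1
  · have h2 : |w.re| ≤ |x₁| := by
      rw [abs_of_nonpos h0, abs_of_nonpos (h1.trans h0)]; linarith
    calc ‖Φ w‖ ≤ D := hwg.trans (by rw [hD]; gcongr)
      _ ≤ (S + D + C) * 1 := by linarith
      _ ≤ _ := by gcongr
  · have h2 : Real.exp w.re ≤ ρ / 2 := by rw [← hx₁]; exact Real.exp_le_exp.2 h1
    have h3 := hs w ⟨hw, by linarith⟩
    have h4 : ‖Φ w‖ ≤ S := by
      rw [← h3.tsum_eq]
      refine tsum_of_norm_bounded hsum.hasSum fun p => ?_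
      rw [norm_mul, norm_pow, Complex.norm_exp]
      gcongr
    calc ‖Φ w‖ ≤ S := h4
      _ ≤ (S + D + C) * 1 := by linarith [show 0 ≤ D by positivity]
      _ ≤ _ := by gcongr

/-! ### Borel transforms of convergent series are entire of Gaussian growth -/

/-- The sum of the Borel transform, in the logarithmic chart. -/
def borelSum (q : ℝ) (g : ℂ⟦X⟧) (u : ℂ) : ℂ := ∑' p : ℕ, borelCoeff q g p * exp u ^ p

/-- The exponent is written so that the right side is a term of the theta series at x + m, with m =
log M. Casts through ℤ allow summation as a subseries. -/
lemma IsConvergent.exists_borel_bound (hq : 1 < q) {g : ℂ⟦X⟧} (hg : IsConvergent g) :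
    ∃ C m : ℝ, 0 < C ∧ ∀ (p : ℕ) (x : ℝ), ‖borelCoeff q g p‖ * Real.exp x ^ p ≤
      C * Real.exp ((p : ℤ) * (x + m) - Real.log q * ((p : ℤ) * ((p : ℤ) - 1) / 2)) := by
  obtain ⟨C, M, hC, hM, h⟩ := isConvergent_iff.1 hg
  refine ⟨C, Real.log M, hC, fun p x => ?_⟩
  rw [norm_borelCoeff hq, pow_mul_pred_div_two hq, div_eq_mul_inv, ← Real.exp_neg,
    ← Real.exp_nat_mul]
  have hMp : M ^ p = Real.exp (p * Real.log M) := by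
    rw [Real.exp_nat_mul, Real.exp_log hM]
  have h1 := h p
  rw [hMp] at h1
  calc _ ≤ C * Real.exp (p * Real.log M) * Real.exp (-(Real.log q * (p * (p - 1) / 2))) *
        Real.exp (p * x) := by gcongr
    _ = _ := by
      rw [mul_assoc, mul_assoc, ← Real.exp_add, ← Real.exp_add]
      congr 2; push_cast; ring

lemma IsConvergent.summable_borel (hq : 1 < q) {g : ℂ⟦X⟧} (hg : IsConvergent g) (x : ℝ) :
    Summable fun p : ℕ => ‖borelCoeff q g p‖ * Real.exp x ^ p := by
  obtain ⟨C, m, hC, h⟩ := hg.exists_borel_bound hq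
  exact Summable.of_nonneg_of_le (fun p => by positivity) (fun p => h p x)
    (((hasSum_norm_logTheta hq (x + m)).summable.comp_injective Nat.cast_injective).mul_left C)

lemma norm_borelCoeff_mul_exp_pow_le (g : ℂ⟦X⟧) {u : ℂ} {x : ℝ} (h : u.re ≤ x) (p : ℕ) :
    ‖borelCoeff q g p * exp u ^ p‖ ≤ ‖borelCoeff q g p‖ * Real.exp x ^ p := by
  rw [norm_mul, norm_pow, Complex.norm_exp]
  gcongr

lemma IsConvergent.hasSum_borelSum (hq : 1 < q) {g : ℂ⟦X⟧} (hg : IsConvergent g) (u : ℂ) :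
    HasSum (fun p : ℕ => borelCoeff q g p * exp u ^ p) (borelSum q g u) :=
  (Summable.of_norm_bounded (hg.summable_borel hq u.re) fun p =>
    norm_borelCoeff_mul_exp_pow_le g le_rfl p).hasSum

lemma IsConvergent.differentiable_borelSum (hq : 1 < q) {g : ℂ⟦X⟧} (hg : IsConvergent g) :
    Differentiable ℂ (borelSum q g) := by
  intro u
  have ho : IsOpen {v : ℂ | v.re < u.re + 1} := isOpen_lt (by fun_prop) continuous_const
  refine (differentiableOn_tsum_of_summable_norm (hg.summable_borel hq (u.re + 1))
    (fun p => Differentiable.differentiableOn (by fun_prop)) ho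
    fun p v hv => norm_borelCoeff_mul_exp_pow_le g (le_of_lt hv) p).differentiableAt
    (ho.mem_nhds (by simp))

lemma IsConvergent.exists_norm_borelSum_le (hq : 1 < q) {g : ℂ⟦X⟧} (hg : IsConvergent g) :
    ∃ C κ : ℝ, 0 < C ∧ 0 ≤ κ ∧ ∀ u : ℂ, ‖borelSum q g u‖ ≤ C * growth q κ u.re := by
  have hL := log_pos_of_one_lt hq
  obtain ⟨C, m, hC, h⟩ := hg.exists_borel_bound hq
  obtain ⟨C', hC', h'⟩ := exists_norm_logTheta_le hq 0
  set L := Real.log q with hLdef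
  refine ⟨C * (C' * Real.exp (m ^ 2 / (2 * L) + m / 2)), |m| / L + 1 / 2, by positivity,
    by positivity, fun u => ?_⟩
  set x := max u.re 0 with hx
  have hx0 : 0 ≤ x := le_max_right _ _
  have h1 : ‖borelSum q g u‖ ≤ C * ‖logTheta q ((x + m : ℝ) : ℂ)‖ := by
    refine (tsum_of_norm_bounded (hg.summable_borel hq x).hasSum fun p =>
      norm_borelCoeff_mul_exp_pow_le g (le_max_left _ _) p).trans ?_
    have hs := hasSum_norm_logTheta hq (x + m)
    have hs' := hs.summable.comp_injective (Nat.cast_injective (R := ℤ))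
    calc _ ≤ ∑' p : ℕ, C * Real.exp ((p : ℤ) * (x + m) - L * ((p : ℤ) * ((p : ℤ) - 1) / 2)) :=
          (hg.summable_borel hq x).tsum_le_tsum (fun p => h p x) (hs'.mul_left C)
      _ ≤ _ := by
        rw [tsum_mul_left, ← hs.tsum_eq]
        gcongr
        exact tsum_comp_le_tsum_of_inj hs.summable (fun _ => (Real.exp_pos _).le) Nat.cast_injective
  have h2 := h' ((x + m : ℝ) : ℂ) (by simp)
  rw [ofReal_re] at h2
  calc _ ≤ C * (C' * Real.exp ((x + m) ^ 2 / (2 * L) + (x + m) / 2)) :=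
        h1.trans (by gcongr)
    _ ≤ C * (C' * (Real.exp (m ^ 2 / (2 * L) + m / 2) * growth q (|m| / L + 1 / 2) u.re)) := by
        rw [growth, ← Real.exp_add, ← hx, ← hLdef]
        refine mul_le_mul_of_nonneg_left (mul_le_mul_of_nonneg_left (Real.exp_le_exp.2 ?_) hC'.le)
          hC.le
        have h3 : (x + m) ^ 2 / (2 * L) + (x + m) / 2 =
          m ^ 2 / (2 * L) + m / 2 + (x ^ 2 / (2 * L) + (m / L + 1 / 2) * x) := by field_simp; ring
        rw [h3]
        gcongr
        exact le_abs_self m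
    _ = _ := by ring

lemma growth_mono_exponent {κ κ' : ℝ} (h : κ ≤ κ') (s : ℝ) : growth q κ s ≤ growth q κ' s := by
  unfold growth
  gcongr

/-- A factor |ξ|^n costs n in the exponent κ, so polynomial factors preserve the growth class. -/
lemma growth_mul_pow_exp_le (κ s : ℝ) (n : ℕ) :
    growth q κ s * Real.exp s ^ n ≤ growth q (κ + n) s := by
  rw [growth, growth, ← Real.exp_nat_mul, ← Real.exp_add, Real.exp_le_exp]
  have : (n : ℝ) * s ≤ n * max s 0 := by gcongr; exact le_max_left _ _
  linarith

lemma exists_norm_polynomial_mul_le {C κ : ℝ} {Φ : ℂ → ℂ} {U : Set ℂ}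
    (hΦ : ∀ u ∈ U, ‖Φ u‖ ≤ C * growth q κ u.re) (hC : 0 < C) (P : Polynomial ℂ) :
    ∃ C' : ℝ, 0 < C' ∧ ∀ u ∈ U,
      ‖P.eval (exp u) * Φ u‖ ≤ C' * growth q (κ + P.natDegree) u.re := by
  have hs : 0 ≤ ∑ k ∈ Finset.range (P.natDegree + 1), ‖P.coeff k‖ :=
    Finset.sum_nonneg fun _ _ => norm_nonneg _
  refine ⟨(∑ k ∈ Finset.range (P.natDegree + 1), ‖P.coeff k‖ + 1) * C, by positivity,
    fun u hu => ?_⟩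
  rw [Polynomial.eval_eq_sum_range, Finset.sum_mul]
  have h1 : ∀ k ∈ Finset.range (P.natDegree + 1), ‖P.coeff k * exp u ^ k * Φ u‖ ≤
      ‖P.coeff k‖ * (C * growth q (κ + P.natDegree) u.re) := by
    intro k hk
    rw [norm_mul, norm_mul, norm_pow, Complex.norm_exp, mul_assoc]
    refine mul_le_mul_of_nonneg_left ?_ (norm_nonneg _)
    calc Real.exp u.re ^ k * ‖Φ u‖ ≤ Real.exp u.re ^ k * (C * growth q κ u.re) := by
          gcongr; exact hΦ u hu
      _ = C * (growth q κ u.re * Real.exp u.re ^ k) := by ring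
      _ ≤ C * growth q (κ + k) u.re := by gcongr; exact growth_mul_pow_exp_le _ _ _
      _ ≤ _ := by
        refine mul_le_mul_of_nonneg_left (growth_mono_exponent ?_ _) hC.le
        have : (k : ℝ) ≤ P.natDegree := by
          exact_mod_cast Nat.lt_succ_iff.1 (Finset.mem_range.1 hk)
        linarith
  refine (norm_sum_le_of_le _ h1).trans ?_
  rw [← Finset.sum_mul, ← mul_assoc]
  have := growth_pos q (κ + P.natDegree) u.re
  gcongr
  linarith

/-! ### The Laplace transform and the operator `z σ_q` -/

/-- The functional equation with shift -k: applying (zσ_q)^k to the kernel in z multiplies it by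
ξ^k. -/
lemma exp_div_logTheta_sub (hq : 1 < q) (u w : ℂ) (k : ℕ) :
    exp (k * w + Real.log q * (k * (k - 1) / 2)) / logTheta q (u - (w + k * Real.log q)) =
      exp u ^ k / logTheta q (u - w) := by
  have h := logTheta_add_int_mul_log hq (u - w) (-k)
  have h1 : u - w + ((-k : ℤ) : ℂ) * Real.log q = u - (w + k * Real.log q) := by push_cast; ring
  rw [h1] at h
  rw [h, ← div_div, ← Complex.exp_sub, ← Complex.exp_nat_mul]
  congr 2; push_cast; ring

/-- The Laplace transform intertwines `P(z σ_q)` with multiplication by `P`. -/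
lemma HasGrowth.functionOp_eq (hq : 1 < q) {d ε C κ : ℝ} {Φ F : ℂ → ℂ}
    (h : HasGrowth q d ε C κ Φ) (hε : 0 < ε) (P : Polynomial ℂ) {w : ℂ} (hw : |d - w.im| < Real.pi)
    (hre : w.re + P.natDegree * Real.log q ≤ -(Real.log q * (κ + 1)))
    (hF : ∀ k ≤ P.natDegree, F (w + k * Real.log q) =
      1 / (Real.log q : ℂ) * logLaplace q Φ d (w + k * Real.log q)) :
    Integrable (fun s : ℝ =>
      P.eval (exp (s + d * I)) * Φ (s + d * I) / logTheta q (s + d * I - w)) ∧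
    functionOp q P F w = 1 / (Real.log q : ℂ) *
      ∫ s : ℝ, P.eval (exp (s + d * I)) * Φ (s + d * I) / logTheta q (s + d * I - w) := by
  have hL := log_pos_of_one_lt hq
  have hpt : ∀ s : ℝ, P.eval (exp (s + d * I)) * Φ (s + d * I) / logTheta q (s + d * I - w) =
      ∑ k ∈ Finset.range (P.natDegree + 1), P.coeff k *
        exp (k * w + Real.log q * (k * (k - 1) / 2)) *
        (Φ (s + d * I) / logTheta q (s + d * I - (w + k * Real.log q))) := by
    intro s
    rw [Polynomial.eval_eq_sum_range, Finset.sum_mul, Finset.sum_div]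
    refine Finset.sum_congr rfl fun k _ => ?_
    have := exp_div_logTheta_sub hq (s + d * I) w k
    calc _ = P.coeff k * Φ (s + d * I) * (exp (s + d * I) ^ k / logTheta q (s + d * I - w)) := by
          ring
      _ = _ := by rw [← this]; ring
  have hint : ∀ k ∈ Finset.range (P.natDegree + 1), Integrable fun s : ℝ => P.coeff k *
        exp (k * w + Real.log q * (k * (k - 1) / 2)) *
        (Φ (s + d * I) / logTheta q (s + d * I - (w + k * Real.log q))) := by
    intro k hk
    refine (h.integrable hq (by simp; positivity) (by simpa using hw) ?_).const_mul _
    have hk' : (k : ℝ) ≤ P.natDegree := by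
      exact_mod_cast Nat.lt_succ_iff.1 (Finset.mem_range.1 hk)
    have : (k : ℝ) * Real.log q ≤ P.natDegree * Real.log q := by gcongr
    simp only [add_re, mul_re, natCast_re, ofReal_re, natCast_im, ofReal_im]
    linarith
  simp only [hpt]
  refine ⟨integrable_finsetSum _ hint, ?_⟩
  rw [integral_finsetSum _ hint, functionOp_apply, Finset.mul_sum]
  refine Finset.sum_congr rfl fun k hk => ?_
  rw [integral_const_mul, hF k (Nat.lt_succ_iff.1 (Finset.mem_range.1 hk)), logLaplace]
  ring

lemma logTheta_ray (d s : ℝ) {w : ℂ} (hw : w.im = d) :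
    logTheta q (s + d * I - w) = logTheta q ((s - w.re : ℝ) : ℂ) := by
  congr 1
  apply Complex.ext <;> simp [hw]

lemma exp_pow_div_logTheta_ray (hq : 1 < q) (d s : ℝ) {w : ℂ} (hw : w.im = d) (p : ℕ) :
    exp (s + d * I) ^ p / logTheta q (s + d * I - w) =
      exp w ^ p * ((Real.exp (p * (s - w.re)) * ‖logTheta q ((s - w.re : ℝ) : ℂ)‖⁻¹ : ℝ) : ℂ) := by
  rw [logTheta_ray d s hw, (exists_logTheta_ofReal hq (s - w.re)).2]
  push_cast
  rw [← Complex.exp_nat_mul, ← Complex.exp_nat_mul, div_eq_mul_inv, ← mul_assoc, ← Complex.exp_add]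
  have h1 : (s + d * I : ℂ) = w + (s - w.re) := by
    apply Complex.ext <;> simp [hw]
  rw [h1, mul_add]
  simp

/-- Along the ray in direction `d`, the Laplace transform inverts the Borel transform on
convergent series. -/
lemma logLaplace_borelSum (hq : 1 < q) (g : ℂ⟦X⟧) (d : ℝ) {w : ℂ}
    (hw : w.im = d) (hs : Summable fun p : ℕ => ‖coeff p g‖ * Real.exp w.re ^ p) :
    logLaplace q (borelSum q g) d w = Real.log q * ∑' p : ℕ, coeff p g * exp w ^ p := by
  have hL := log_pos_of_one_lt hq
  have hq0 : 0 < q := by linarith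
  set k : ℕ → ℝ → ℝ := fun p t => Real.exp (p * t) * ‖logTheta q t‖⁻¹ with hk
  have hk0 : ∀ p t, 0 ≤ k p t := fun p t => by positivity
  have hki : ∀ p, Integrable fun s => k p (s - w.re) := fun p =>
    (integrable_exp_mul_inv_norm_logTheta hq p).comp_sub_right w.re
  have hkint : ∀ p, ∫ s, k p (s - w.re) = Real.log q * q ^ (p * (p - 1) / 2) := fun p => by
    rw [integral_sub_right_eq_self (k p)]; exact integral_exp_mul_inv_norm_logTheta hq p
  have hpt : ∀ s : ℝ, borelSum q g (s + d * I) / logTheta q (s + d * I - w) =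
      ∑' p : ℕ, borelCoeff q g p * exp w ^ p * (k p (s - w.re) : ℂ) := by
    intro s
    rw [borelSum, ← tsum_div_const]
    refine tsum_congr fun p => ?_
    rw [mul_div_assoc, exp_pow_div_logTheta_ray hq d s hw, mul_assoc]
  have hb : ∀ p, borelCoeff q g p * (q : ℂ) ^ (p * (p - 1) / 2) = coeff p g := fun p =>
    div_mul_cancel₀ _ (pow_ne_zero _ (ofReal_ne_zero_of_one_lt hq))
  have hnorm : ∀ p, ∫ s : ℝ, ‖borelCoeff q g p * exp w ^ p * (k p (s - w.re) : ℂ)‖ =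
      Real.log q * (‖coeff p g‖ * Real.exp w.re ^ p) := by
    intro p
    have h1 : ∀ s : ℝ, ‖borelCoeff q g p * exp w ^ p * (k p (s - w.re) : ℂ)‖ =
        ‖borelCoeff q g p‖ * Real.exp w.re ^ p * k p (s - w.re) := fun s => by
      rw [norm_mul, norm_mul, norm_pow, Complex.norm_exp, Complex.norm_real,
        Real.norm_of_nonneg (hk0 _ _)]
    simp only [h1]
    rw [integral_const_mul, hkint, ← hb p, norm_mul, norm_pow, Complex.norm_real,
      Real.norm_of_nonneg hq0.le]
    ring
  -- Termwise integration is legitimate because the kernel is positive on the ray: the L¹ norms are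
  -- exactly ln q·|g_p||z|^p, the moment restoring the Borel weight.
  have hsum := hasSum_integral_of_summable_integral_norm
    (F := fun (p : ℕ) (s : ℝ) => borelCoeff q g p * exp w ^ p * (k p (s - w.re) : ℂ))
    (fun p => (hki p).ofReal.const_mul _) (by
      simp only [hnorm]; exact hs.mul_left _)
  rw [logLaplace]
  simp only [hpt]
  rw [← hsum.tsum_eq, ← tsum_mul_left]
  refine tsum_congr fun p => ?_
  rw [integral_const_mul, integral_complex_ofReal, hkint, ← hb p]
  push_cast; ring

/-! ### Asymptotics of the Laplace transform along a ray -/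

lemma tendsto_coeff_of_hasSum {c : ℕ → ℂ} {A : ℝ → ℂ} {d s₀ : ℝ} {N : ℕ}
    (hA : ∀ s ≤ s₀, HasSum (fun p : ℕ => c p * exp (s + d * I) ^ p) (A s))
    (hN : ∀ p < N, c p = 0) :
    Tendsto (fun s : ℝ => A s * (exp (s + d * I) ^ N)⁻¹) atBot (𝓝 (c N)) := by
  have hne : ∀ s : ℝ, exp (s + d * I) ^ N ≠ 0 := fun s => pow_ne_zero _ (Complex.exp_ne_zero _)
  have h1 : ∀ s ≤ s₀, HasSum (fun p : ℕ => c (p + N) * exp (s + d * I) ^ p)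
      (A s * (exp (s + d * I) ^ N)⁻¹) := by
    intro s hs
    have h := (hasSum_nat_add_iff' N).2 (hA s hs)
    rw [Finset.sum_eq_zero (fun i hi => by rw [hN i (Finset.mem_range.1 hi), zero_mul]),
      sub_zero] at h
    refine (h.mul_right (exp (s + d * I) ^ N)⁻¹).congr_fun fun p => ?_
    rw [pow_add, mul_assoc, mul_assoc, mul_inv_cancel₀ (hne s), mul_one]
  have hnorm : ∀ s : ℝ, ‖exp (s + d * I)‖ = Real.exp s := fun s => by
    rw [Complex.norm_exp]; simp
  have hz : Tendsto (fun s : ℝ => exp (s + d * I)) atBot (𝓝 0) := by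
    rw [tendsto_zero_iff_norm_tendsto_zero]
    simp only [hnorm]
    exact Real.tendsto_exp_atBot
  have hlim := tendsto_tsum_of_dominated_convergence (𝓕 := atBot)
    (bound := fun p : ℕ => ‖c (p + N) * exp (s₀ + d * I) ^ p‖)
    (f := fun (s : ℝ) (p : ℕ) => c (p + N) * exp (s + d * I) ^ p)
    (g := fun p => c (p + N) * (0 : ℂ) ^ p)
    (h1 s₀ le_rfl).summable.norm (fun p => (hz.pow p).const_mul _)
    (by
      filter_upwards [eventually_le_atBot s₀] with s hs p
      rw [norm_mul, norm_mul, norm_pow, norm_pow, hnorm, hnorm]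
      gcongr)
  rw [tsum_eq_single 0 (fun p hp => by rw [zero_pow hp, mul_zero]), pow_zero, mul_one,
    zero_add] at hlim
  refine hlim.congr' ?_
  filter_upwards [eventually_le_atBot s₀] with s hs
  exact (h1 s hs).tsum_eq

/-- Watson's lemma along a ray: the leading coefficient of the Laplace transform. -/
lemma tendsto_laplace_leading (hq : 1 < q) {c : ℕ → ℂ} {A : ℝ → ℂ} {d s₀ C κ : ℝ} {N : ℕ}
    (hAc : Continuous A) (hC : 0 < C) (hκ : 0 ≤ κ)
    (hAg : ∀ s, ‖A s‖ ≤ C * growth q κ s)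
    (hA : ∀ s ≤ s₀, HasSum (fun p : ℕ => c p * exp (s + d * I) ^ p) (A s))
    (hN : ∀ p < N, c p = 0) :
    Tendsto (fun x : ℝ => (exp (x + d * I) ^ N)⁻¹ * ∫ s : ℝ, A s / logTheta q ((s - x : ℝ) : ℂ))
      atBot (𝓝 (c N * (Real.log q * q ^ (N * (N - 1) / 2) : ℝ))) := by
  have hL := log_pos_of_one_lt hq
  set B : ℝ → ℂ := fun s => A s * (exp (s + d * I) ^ N)⁻¹ with hB
  have hBlim : Tendsto B atBot (𝓝 (c N)) := tendsto_coeff_of_hasSum hA hN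
  have hBc : Continuous B := hAc.mul
    (Continuous.inv₀ (by fun_prop) fun s => pow_ne_zero _ (Complex.exp_ne_zero _))
  have hnorm : ∀ s : ℝ, ‖exp (s + d * I)‖ = Real.exp s := fun s => by
    rw [Complex.norm_exp]; simp
  -- Dividing by ξ^N is harmless: near ξ = 0 the quotient is bounded because it converges, and
  -- elsewhere |ξ|^{-N} is bounded.
  obtain ⟨C', hC', hBg⟩ : ∃ C' : ℝ, 0 < C' ∧ ∀ s, ‖B s‖ ≤ C' * growth q κ s := by
    obtain ⟨s₁, hs₁⟩ := eventually_atBot.1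
      (hBlim.norm.eventually (gt_mem_nhds (lt_add_one ‖c N‖)))
    set s₂ := min s₁ 0
    refine ⟨‖c N‖ + 1 + C * (Real.exp s₂ ^ N)⁻¹, by positivity, fun s => ?_⟩
    rcases le_total s s₂ with hs | hs
    · have h1 : ‖B s‖ ≤ ‖c N‖ + 1 := (hs₁ s (hs.trans (min_le_left _ _))).le
      have h2 : 0 ≤ C * (Real.exp s₂ ^ N)⁻¹ := by positivity
      calc ‖B s‖ ≤ (‖c N‖ + 1 + C * (Real.exp s₂ ^ N)⁻¹) * 1 := by linarith
        _ ≤ _ := by gcongr; exact one_le_growth hq hκ s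
    · rw [hB]
      simp only
      rw [norm_mul, norm_inv, norm_pow, hnorm]
      calc ‖A s‖ * (Real.exp s ^ N)⁻¹ ≤ (C * growth q κ s) * (Real.exp s₂ ^ N)⁻¹ := by
            have := growth_pos q κ s
            gcongr
            exact hAg s
        _ = (C * (Real.exp s₂ ^ N)⁻¹) * growth q κ s := by ring
        _ ≤ _ := by
          have := growth_pos q κ s
          gcongr
          have : 0 ≤ ‖c N‖ := norm_nonneg _
          linarith
  set k : ℝ → ℝ := fun t => Real.exp (N * t) * ‖logTheta q t‖⁻¹ with hk
  have hk0 : ∀ t, 0 ≤ k t := fun t => by positivity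
  have hkc : Continuous k := Continuous.mul (by fun_prop) (continuous_inv_norm_logTheta_ofReal hq)
  -- The translation s = t + x moves all dependence on z into B. As x → -∞ the factor B(t + x) tends
  -- to c N, leaving the N-th moment.
  have hrew : ∀ x : ℝ, (exp (x + d * I) ^ N)⁻¹ * ∫ s : ℝ, A s / logTheta q ((s - x : ℝ) : ℂ) =
      ∫ t : ℝ, B (t + x) * (k t : ℂ) := by
    intro x
    rw [← integral_const_mul, ← integral_add_right_eq_self _ x]
    refine integral_congr_ae (Eventually.of_forall fun t => ?_)
    have h1 : exp ((t + x : ℝ) + d * I) ^ N = exp (x + d * I) ^ N * exp (N * t) := by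
      rw [← Complex.exp_nat_mul, ← Complex.exp_nat_mul, ← Complex.exp_add]
      congr 1; push_cast; ring
    simp only [hB, hk]
    rw [h1, add_sub_cancel_right, (exists_logTheta_ofReal hq t).2]
    have h3 := Complex.exp_ne_zero (N * t)
    have h4 : exp (x + d * I) ^ N ≠ 0 := pow_ne_zero _ (Complex.exp_ne_zero _)
    have h5 : (‖logTheta q t‖ : ℂ) ≠ 0 := by exact_mod_cast (exists_logTheta_ofReal hq t).1.ne'
    simp only [Complex.norm_real, norm_norm]
    push_cast
    field_simp
  simp only [hrew]
  -- The threshold for growth κ + N, as k carries an extra e^{Nt}. Monotonicity of `growth` lets the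
  -- majorant at x₀ serve all x ≤ x₀.
  set x₀ := -(Real.log q * ((κ + N) + 1)) with hx₀
  obtain ⟨K₁, hK₁, h₁⟩ := exists_norm_inv_logTheta_le hq Real.pi_pos
  obtain ⟨K₂, hK₂, h₂⟩ := exists_growth_mul_kernel_le hq (κ + N) x₀
  have hdom : ∀ t, growth q κ (t + x₀) * k t ≤
      Real.exp (-(N * x₀)) * K₁ * K₂ * (1 + (t + x₀) ^ 2)⁻¹ := by
    intro t
    have e1 := h₁ t (by simp)
    have e2 := h₂ x₀ (t + x₀) le_rfl le_rfl
    have e3 := growth_mul_pow_exp_le (q := q) κ (t + x₀) N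
    rw [ofReal_re, norm_inv] at e1
    rw [add_sub_cancel_right] at e2
    have e4 : Real.exp (N * t) = Real.exp (-(N * x₀)) * Real.exp (t + x₀) ^ N := by
      rw [← Real.exp_nat_mul, ← Real.exp_add]; congr 1; ring
    have := growth_pos q κ (t + x₀)
    calc growth q κ (t + x₀) * k t = Real.exp (-(N * x₀)) *
          (growth q κ (t + x₀) * Real.exp (t + x₀) ^ N) * ‖logTheta q t‖⁻¹ := by
          rw [hk]; simp only; rw [e4]; ring
      _ ≤ Real.exp (-(N * x₀)) * growth q (κ + N) (t + x₀) *
          (K₁ * Real.exp (-(t ^ 2 / (2 * Real.log q) + t / 2))) := by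
          have := growth_pos q (κ + N) (t + x₀)
          gcongr
      _ = Real.exp (-(N * x₀)) * K₁ * (growth q (κ + N) (t + x₀) *
          Real.exp (-(t ^ 2 / (2 * Real.log q) + t / 2))) := by ring
      _ ≤ Real.exp (-(N * x₀)) * K₁ * (K₂ * (1 + (t + x₀) ^ 2)⁻¹) := by gcongr
      _ = _ := by ring
  have hint : ∫ t : ℝ, c N * (k t : ℂ) = c N * (Real.log q * q ^ (N * (N - 1) / 2) : ℝ) := by
    rw [integral_const_mul, integral_complex_ofReal, integral_exp_mul_inv_norm_logTheta hq]
  rw [← hint]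
  refine tendsto_integral_filter_of_dominated_convergence
    (fun t => C' * (Real.exp (-(N * x₀)) * K₁ * K₂ * (1 + (t + x₀) ^ 2)⁻¹)) ?_ ?_ ?_ ?_
  · refine Eventually.of_forall fun x => (Continuous.mul (hBc.comp (by fun_prop))
      (continuous_ofReal.comp hkc)).aestronglyMeasurable
  · filter_upwards [eventually_le_atBot x₀] with x hx
    refine Eventually.of_forall fun t => ?_
    rw [norm_mul, Complex.norm_real, Real.norm_of_nonneg (hk0 t)]
    calc ‖B (t + x)‖ * k t ≤ C' * growth q κ (t + x₀) * k t := by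
          have := hk0 t
          gcongr
          exact (hBg _).trans (by gcongr; exact growth_mono hq hκ (by linarith))
      _ ≤ _ := by rw [mul_assoc]; exact mul_le_mul_of_nonneg_left (hdom t) hC'.le
  · exact ((integrable_inv_one_add_sq.comp_add_right x₀).const_mul _).const_mul _
  · refine Eventually.of_forall fun t => ?_
    exact (hBlim.comp (tendsto_atBot_add_const_left _ t tendsto_id)).mul_const _

end QGevrey

end

noncomputable section

open Complex Filter Topology MeasureTheory Set PowerSeries

namespace QGevrey

variable {q : ℝ}

/-! ### Polynomials on sectors free of roots -/

lemma exists_le_norm_ofReal_sub {σ : ℂ} (h : ∀ t : ℝ, 0 ≤ t → (t : ℂ) ≠ σ) :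
    ∃ c : ℝ, 0 < c ∧ ∀ t : ℝ, 0 ≤ t → c ≤ ‖(t : ℂ) - σ‖ := by
  by_cases him : σ.im = 0
  · have hre : σ.re < 0 := by
      by_contra hle
      exact h σ.re (not_lt.1 hle) (Complex.ext (by simp) (by simp [him]))
    refine ⟨-σ.re, by linarith, fun t ht => ?_⟩
    have := (le_abs_self _).trans (abs_re_le_norm ((t : ℂ) - σ))
    rw [sub_re, ofReal_re] at this
    linarith
  · refine ⟨|σ.im|, abs_pos.2 him, fun t _ => ?_⟩
    simpa using abs_im_le_norm ((t : ℂ) - σ)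

/-- Rotate the ray to the positive axis, which stays at distance c from the rotated point σ. A
further rotation by less than η moves σ by at most c/2. -/
lemma exists_le_norm_exp_sub {a : ℂ} {d : ℝ} (h : ∀ t : ℝ, 0 ≤ t → t * exp (d * I) ≠ a) :
    ∃ η c : ℝ, 0 < η ∧ 0 < c ∧ ∀ w : ℂ, |w.im - d| < η → c ≤ ‖exp w - a‖ := by
  set σ := a * exp (-(d * I)) with hσ
  have hσa : σ * exp (d * I) = a := by
    rw [hσ, mul_assoc, ← Complex.exp_add, neg_add_cancel, Complex.exp_zero, mul_one]
  obtain ⟨c, hc, hcb⟩ := exists_le_norm_ofReal_sub (σ := σ) (fun t ht hts =>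
    h t ht (by rw [hts, hσa]))
  refine ⟨c / (2 * (‖σ‖ + 1)), c / 2, by positivity, by positivity, fun w hw => ?_⟩
  set τ := d - w.im with hτ
  have h1 : exp w - a = exp (w.im * I) * ((Real.exp w.re : ℂ) - σ * exp (I * τ)) := by
    have e1 : exp w = exp (w.im * I) * (Real.exp w.re : ℂ) := by
      rw [ofReal_exp, ← Complex.exp_add]
      congr 1
      conv_lhs => rw [← re_add_im w, add_comm]
    have e2 : a = exp (w.im * I) * (σ * exp (I * τ)) := by
      rw [mul_left_comm, ← Complex.exp_add]
      conv_lhs => rw [← hσa]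
      congr 2
      rw [hτ]; push_cast; ring
    rw [mul_sub, ← e1, ← e2]
  have h2 : ‖exp w - a‖ = ‖(Real.exp w.re : ℂ) - σ * exp (I * τ)‖ := by
    rw [h1, norm_mul, norm_exp_ofReal_mul_I, one_mul]
  have h3 : ‖σ * (exp (I * τ) - 1)‖ ≤ c / 2 := by
    rw [norm_mul]
    have h4 : ‖exp (I * τ) - 1‖ ≤ c / (2 * (‖σ‖ + 1)) := by
      refine (Real.norm_exp_I_mul_ofReal_sub_one_le).trans ?_
      rw [Real.norm_eq_abs, hτ, abs_sub_comm]
      exact hw.le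
    calc ‖σ‖ * ‖exp (I * τ) - 1‖ ≤ (‖σ‖ + 1) * (c / (2 * (‖σ‖ + 1))) := by gcongr; linarith
      _ = c / 2 := by field_simp
  have h5 := hcb (Real.exp w.re) (Real.exp_pos _).le
  have h6 : (Real.exp w.re : ℂ) - σ =
      ((Real.exp w.re : ℂ) - σ * exp (I * τ)) + σ * (exp (I * τ) - 1) := by ring
  rw [h6] at h5
  have h7 := norm_add_le ((Real.exp w.re : ℂ) - σ * exp (I * τ)) (σ * (exp (I * τ) - 1))
  rw [h2]
  linarith

lemma exists_le_norm_eval_exp {h : Polynomial ℂ} (h0 : h.eval 0 ≠ 0) {d : ℝ}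
    (hd : ¬ IsRootArgument h d) :
    ∃ η c : ℝ, 0 < η ∧ 0 < c ∧ ∀ w : ℂ, |w.im - d| < η → c ≤ ‖h.eval (exp w)‖ := by
  have hne := ne_zero_of_eval_zero h0
  have hroots : ∀ s : Multiset ℂ, (∀ a ∈ s, ∀ t : ℝ, 0 ≤ t → t * exp (d * I) ≠ a) →
      ∃ η c : ℝ, 0 < η ∧ 0 < c ∧ ∀ w : ℂ, |w.im - d| < η →
        c ≤ ‖(s.map fun a => exp w - a).prod‖ := by
    intro s
    induction s using Multiset.induction_on with
    | empty => exact fun _ => ⟨1, 1, one_pos, one_pos, fun w _ => by simp⟩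
    | cons a s ih =>
      intro hs
      obtain ⟨η₁, c₁, hη₁, hc₁, h₁⟩ := ih fun b hb => hs b (Multiset.mem_cons_of_mem hb)
      obtain ⟨η₂, c₂, hη₂, hc₂, h₂⟩ := exists_le_norm_exp_sub (hs a (Multiset.mem_cons_self a s))
      refine ⟨min η₁ η₂, c₂ * c₁, lt_min hη₁ hη₂, by positivity, fun w hw => ?_⟩
      rw [Multiset.map_cons, Multiset.prod_cons, norm_mul]
      exact mul_le_mul (h₂ w (hw.trans_le (min_le_right _ _)))
        (h₁ w (hw.trans_le (min_le_left _ _))) hc₁.le (norm_nonneg _)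
  obtain ⟨η, c, hη, hc, hb⟩ := hroots h.roots fun a ha t ht hta => by
    have hr : h.IsRoot a := (Polynomial.mem_roots hne).1 ha
    rcases ht.eq_or_lt with rfl | ht
    · rw [← hta] at hr
      exact h0 (by simpa using hr)
    · exact hd ⟨t, ht, hta ▸ hr⟩
  have hl : 0 < ‖h.leadingCoeff‖ := norm_pos_iff.2 (Polynomial.leadingCoeff_ne_zero.2 hne)
  refine ⟨η, ‖h.leadingCoeff‖ * c, hη, by positivity, fun w hw => ?_⟩
  rw [(IsAlgClosed.splits h).eq_prod_roots, Polynomial.eval_mul, Polynomial.eval_C, norm_mul,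
    Polynomial.eval_multiset_prod, Multiset.map_map]
  rw [(IsAlgClosed.splits h).eq_prod_roots.symm]
  refine mul_le_mul_of_nonneg_left ?_ (norm_nonneg _)
  simpa using hb w hw

/-- Finitely many roots have finitely many principal arguments, while (-π, π] is infinite. -/
lemma exists_not_isRootArgument {h : Polynomial ℂ} (hne : h ≠ 0) :
    ∃ d : ℝ, ¬ IsRootArgument h d := by
  by_contra hall
  push Not at hall
  have hfin : (Complex.arg '' {z | h.IsRoot z}).Finite :=
    (Polynomial.finite_setOfPred_isRoot hne).image _
  refine (Ioc_infinite (by linarith [Real.pi_pos] : -Real.pi < Real.pi)) (hfin.subset ?_)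
  intro d hd
  obtain ⟨t, ht, hr⟩ := hall d
  refine ⟨_, hr, ?_⟩
  rw [Complex.exp_mul_I]
  exact Complex.arg_mul_cos_add_sin_mul_I ht hd

/-! ### Sums of Borel summable series -/

/-- In a strip (Im w)² is bounded, costing a constant factor e^{Y²/(2L)}. For Re w ≤ 0 completing
the square costs e^{κ²L/2}. -/
lemma HasGrowth.exists_norm_le (hq : 1 < q) {d ε C κ : ℝ} {Φ : ℂ → ℂ}
    (h : HasGrowth q d ε C κ Φ) :
    ∃ C μ : ℝ, 0 < C ∧ ∀ w ∈ unboundedSector d ε,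
      ‖Φ w‖ ≤ C * ‖exp (μ * w) * exp (w ^ 2 / (2 * Real.log q))‖ := by
  have hL := log_pos_of_one_lt hq
  set L := Real.log q with hLdef
  set Y := |d| + Real.pi * ε / 2 with hY
  refine ⟨C * Real.exp (Y ^ 2 / (2 * L) + κ ^ 2 * L / 2), κ, by have := h.pos; positivity,
    fun w hw => (h.norm_le w hw).trans ?_⟩
  rw [mul_assoc]
  refine mul_le_mul_of_nonneg_left ?_ h.pos.le
  have hn : ‖exp (κ * w) * exp (w ^ 2 / (2 * L))‖ =
      Real.exp (κ * w.re + (w.re ^ 2 - w.im ^ 2) / (2 * L)) := by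
    have h1 : (w ^ 2 / (2 * L) : ℂ) = w ^ 2 / ((2 * L : ℝ) : ℂ) := by push_cast; rfl
    rw [← Complex.exp_add, Complex.norm_exp, add_re, re_ofReal_mul, h1, div_ofReal_re, sq w,
      mul_re, sq, sq]
  rw [hn, growth, ← Real.exp_add, Real.exp_le_exp, ← hLdef]
  have hw' : |w.im| ≤ Y := by
    have h1 : |w.im - d| < Real.pi * ε / 2 := hw
    have h2 := abs_add_le (w.im - d) d
    rw [sub_add_cancel] at h2
    linarith
  have h3 : w.im ^ 2 / (2 * L) ≤ Y ^ 2 / (2 * L) := by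
    have : w.im ^ 2 ≤ Y ^ 2 := by rw [← sq_abs w.im]; gcongr
    gcongr
  have h4 : (w.re ^ 2 - w.im ^ 2) / (2 * L) = w.re ^ 2 / (2 * L) - w.im ^ 2 / (2 * L) := sub_div _ _ _
  rw [h4]
  rcases le_total 0 w.re with h0 | h0
  · rw [max_eq_left h0]
    have : 0 ≤ κ ^ 2 * L / 2 := by positivity
    linarith
  · rw [max_eq_right h0]
    have h5 : 0 ≤ (w.re + κ * L) ^ 2 / (2 * L) := by positivity
    have h6 : (w.re + κ * L) ^ 2 / (2 * L) = κ * w.re + w.re ^ 2 / (2 * L) + κ ^ 2 * L / 2 := by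
      field_simp; ring
    have h7 : (0 : ℝ) ^ 2 / (2 * L) + κ * 0 = 0 := by simp
    rw [h7]
    linarith

lemma sector_iff_re_lt {d θ y : ℝ} {w : ℂ} :
    w ∈ sector d θ (Real.exp y) ↔ |w.im - d| < Real.pi * θ / 2 ∧ w.re < y := by
  simp [sector]

/-- A continued Borel transform yields a sum on a sector of opening larger than `2π`. -/
lemma HasGrowth.exists_isQSum (hq : 1 < q) {f : ℂ⟦X⟧} {d ε C κ : ℝ} {Φ : ℂ → ℂ} (hε : 0 < ε)
    (h : HasGrowth q d ε C κ Φ) (hΦ : IsBorelContinuation q f d ε Φ) :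
    ∃ (θ : ℝ) (F : ℂ → ℂ), 2 < θ ∧ IsQSum q f d θ (Real.exp (-(Real.log q * (κ + 1)))) F ∧
      ∀ w ∈ sector d θ (Real.exp (-(Real.log q * (κ + 1)))), |w.im - d| < Real.pi →
        F w = 1 / (Real.log q : ℂ) * logLaplace q Φ d w := by
  have hπ := Real.pi_pos
  -- The direction of integration is tilted from d by the fraction ε/(4 + ε) of arg z - d. It stays
  -- in the sector of Φ and within π of arg z.
  have hmain : ∀ w : ℂ, |w.im - d| < Real.pi * (2 + ε / 2) / 2 →
      |d + ε / (4 + ε) * (w.im - d) - d| < Real.pi * ε / 2 ∧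
      |d + ε / (4 + ε) * (w.im - d) - w.im| < Real.pi := by
    intro w hw
    have e1 : d + ε / (4 + ε) * (w.im - d) - d = ε / (4 + ε) * (w.im - d) := by ring
    have e2 : d + ε / (4 + ε) * (w.im - d) - w.im = -(4 / (4 + ε) * (w.im - d)) := by
      field_simp; ring
    rw [e1, e2, abs_neg, abs_mul, abs_mul, abs_of_pos (by positivity : 0 < ε / (4 + ε)),
      abs_of_pos (by positivity : 0 < 4 / (4 + ε))]
    constructor
    · calc ε / (4 + ε) * |w.im - d| < ε / (4 + ε) * (Real.pi * (2 + ε / 2) / 2) := by gcongr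
        _ = Real.pi * ε / 4 := by field_simp; ring
        _ < _ := by have : 0 < Real.pi * ε := by positivity
                    linarith
    · calc 4 / (4 + ε) * |w.im - d| < 4 / (4 + ε) * (Real.pi * (2 + ε / 2) / 2) := by gcongr
        _ = Real.pi := by field_simp; ring
  set F : ℂ → ℂ := fun w => 1 / (Real.log q : ℂ) *
    logLaplace q Φ (d + ε / (4 + ε) * (w.im - d)) w with hF
  have hd : |d - d| < Real.pi * ε / 2 := by simp; positivity
  have hFd : ∀ w ∈ sector d (2 + ε / 2) (Real.exp (-(Real.log q * (κ + 1)))),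
      |w.im - d| < Real.pi → F w = 1 / (Real.log q : ℂ) * logLaplace q Φ d w := by
    intro w hw hw'
    obtain ⟨hw₁, hw₂⟩ := sector_iff_re_lt.1 hw
    rw [hF]
    simp only
    rw [h.logLaplace_eq hq (hmain w hw₁).1 hd (hmain w hw₁).2 (by rwa [abs_sub_comm]) hw₂.le]
  refine ⟨2 + ε / 2, F, by linarith, ⟨fun w₀ hw₀ => ?_, ε, hε, Φ, hΦ, fun w hw hw' => ⟨?_, ?_⟩⟩, hFd⟩
  · obtain ⟨h₁, h₂⟩ := sector_iff_re_lt.1 hw₀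
    obtain ⟨h₃, h₄⟩ := hmain w₀ h₁
    set e := d + ε / (4 + ε) * (w₀.im - d)
    have hdiff := (h.differentiableAt_logLaplace hq h₃ h₄ h₂).const_mul (1 / (Real.log q : ℂ))
    -- The tilted direction is not holomorphic in w, but the integral does not depend on it, so near
    -- w₀ it may be frozen at e.
    refine (hdiff.congr_of_eventuallyEq ?_).differentiableWithinAt
    have hev : ∀ᶠ w in 𝓝 w₀, |e - w.im| < Real.pi :=
      (isOpen_lt (f := fun w : ℂ => |e - w.im|) (by fun_prop) continuous_const).mem_nhds h₄
    filter_upwards [hev, (isOpen_sector _ _ _).mem_nhds hw₀] with w hw hws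
    obtain ⟨hw₁, hw₂⟩ := sector_iff_re_lt.1 hws
    rw [hF]
    simp only
    rw [h.logLaplace_eq hq (hmain w hw₁).1 h₃ (hmain w hw₁).2 hw hw₂.le]
  · rw [integrableOn_laplaceIntegrand_iff]
    exact h.integrable hq hd (by rwa [abs_sub_comm]) (sector_iff_re_lt.1 hw).2.le
  · rw [qLaplace_eq]; exact hFd w hw hw'

/-! ### Identity theorem and holomorphy on sectors -/

lemma convex_sector (d θ r : ℝ) : Convex ℝ (sector d θ r) := by
  have h : sector d θ r = (Real.exp ⁻¹' Iio r) ×ℂ Ioo (d - Real.pi * θ / 2) (d + Real.pi * θ / 2) := by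
    ext w
    simp only [sector, mem_ofPred_eq, mem_reProdIm, mem_preimage, mem_Iio, mem_Ioo, abs_lt]
    constructor
    · rintro ⟨⟨h1, h2⟩, h3⟩; exact ⟨h3, by linarith, by linarith⟩
    · rintro ⟨h3, h1, h2⟩; exact ⟨⟨by linarith, by linarith⟩, h3⟩
  rw [h]
  exact ((ordConnected_Iio.preimage_mono Real.exp_monotone).convex.linear_preimage reLm).inter
    ((convex_Ioo _ _).linear_preimage imLm)

lemma eq_zero_on_sector {E : ℂ → ℂ} {d θ r : ℝ} (hθ : 0 < θ) (hr : 0 < r)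
    (hE : DifferentiableOn ℂ E (sector d θ r))
    (h0 : ∀ w ∈ sector d θ r, w.im = d → E w = 0) : ∀ w ∈ sector d θ r, E w = 0 := by
  have hmem : ∀ s : ℝ, s ≤ Real.log (r / 2) → (s + d * I : ℂ) ∈ sector d θ r := by
    intro s hs
    refine ⟨by simp; positivity, ?_⟩
    have : Real.exp s ≤ r / 2 := by
      rw [← Real.exp_log (by positivity : 0 < r / 2)]; exact Real.exp_le_exp.2 hs
    simp only [add_re, ofReal_re, mul_re, I_re, mul_zero, ofReal_im, I_im, sub_zero, zero_mul,
      add_zero]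
    linarith
  set s₀ := Real.log (r / 2)
  have hlim : Tendsto (fun n : ℕ => ((s₀ - 1 / ((n : ℝ) + 1) : ℝ) + d * I : ℂ)) atTop
      (𝓝[≠] (s₀ + d * I : ℂ)) := by
    refine tendsto_nhdsWithin_iff.2 ⟨?_, Eventually.of_forall fun n => ?_⟩
    · have h1 : Tendsto (fun n : ℕ => s₀ - 1 / ((n : ℝ) + 1)) atTop (𝓝 s₀) := by
        simpa using (tendsto_const_nhds (x := s₀)).sub
          (tendsto_one_div_add_atTop_nhds_zero_nat (𝕜 := ℝ))
      exact ((continuous_ofReal.tendsto _).comp h1).add_const _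
    · intro h
      have := congrArg Complex.re h
      have h2 : (0 : ℝ) < 1 / ((n : ℝ) + 1) := by positivity
      simp only [add_re, ofReal_re, mul_re, I_re, mul_zero, ofReal_im, I_im, sub_zero, zero_mul,
        add_zero] at this
      linarith
  have hfreq : ∃ᶠ z in 𝓝[≠] (s₀ + d * I : ℂ), E z = 0 :=
    hlim.frequently (Frequently.of_forall fun n => h0 _ (hmem _ (by
      have h2 : (0 : ℝ) < 1 / ((n : ℝ) + 1) := by positivity
      linarith)) (by simp))
  exact (hE.analyticOnNhd (isOpen_sector d θ r)).eqOn_zero_of_preconnected_of_frequently_eq_zero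
    (convex_sector d θ r).isPreconnected (hmem _ le_rfl) hfreq

lemma add_nat_mul_log_mem_sector (hq : 1 < q) {d θ ρ R : ℝ} {n k : ℕ} (hk : k ≤ n)
    (hρ : q ^ n * ρ ≤ R) {w : ℂ} (hw : w ∈ sector d θ ρ) : w + k * Real.log q ∈ sector d θ R := by
  refine ⟨by simpa using hw.1, ?_⟩
  have h1 : Real.exp w.re < ρ := hw.2
  have hq0 : 0 < q := by linarith
  have h2 : (w + k * Real.log q).re = k * Real.log q + w.re := by simp [add_comm]
  rw [h2, Real.exp_add, Real.exp_nat_mul, Real.exp_log hq0]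
  calc q ^ k * Real.exp w.re ≤ q ^ n * Real.exp w.re := by gcongr; exact hq.le
    _ < q ^ n * ρ := by gcongr
    _ ≤ R := hρ

lemma differentiableOn_tsum_exp {g : ℂ⟦X⟧} {d θ ρ : ℝ} (hg : ConvergesAt g ρ) :
    DifferentiableOn ℂ (fun w => ∑' p : ℕ, coeff p g * exp w ^ p) (sector d θ ρ) := by
  refine differentiableOn_tsum_of_summable_norm hg
    (fun p => Differentiable.differentiableOn (by fun_prop)) (isOpen_sector d θ ρ)
    fun p w hw => ?_
  rw [norm_mul, norm_pow, Complex.norm_exp]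
  have : Real.exp w.re < ρ := hw.2
  gcongr

lemma ConvergesAt.mono {g : ℂ⟦X⟧} {ρ ρ' : ℝ} (h : ConvergesAt g ρ) (h0 : 0 ≤ ρ') (hle : ρ' ≤ ρ) :
    ConvergesAt g ρ' :=
  Summable.of_nonneg_of_le (fun p => by positivity) (fun p => by gcongr) h

lemma hasQGevreyExpansion_zero {G : Set ℂ} {E : ℂ → ℂ} (hq : 1 < q) (h : ∀ w ∈ G, E w = 0) :
    HasQGevreyExpansion q G E 0 := by
  refine ⟨(differentiableOn_const (0 : ℂ)).congr h, fun d θ r _ _ hcl => ⟨1, 1, one_pos, one_pos,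
    fun N w hw => ?_⟩⟩
  rw [h w (hcl (subset_closure hw))]
  simp only [map_zero, zero_mul, Finset.sum_const_zero, sub_zero, norm_zero]
  positivity

/-- The recurrence estimate implies summability to a (quasi-)solution. -/
lemma RecurrenceEstimate.summableToQuasiSolution (hq : 1 < q) {f : ℂ⟦X⟧} {r : ℕ} {a : ℕ → ℂ}
    (h : RecurrenceEstimate q f r a) : SummableToQuasiSolution q f (hPoly r a) := by
  have hL := log_pos_of_one_lt hq
  have hq0 : 0 < q := by linarith
  have hh0 : (hPoly r a).eval 0 ≠ 0 := by rw [hPoly_eval_zero]; exact one_ne_zero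
  set P := hPoly r a with hP
  set g := formalOp q P f with hgdef
  have hg : IsConvergent g := (recurrenceEstimate_iff hq f r a).1 h
  refine ⟨P, g, hh0, hg, fun d hd => ?_⟩
  obtain ⟨η, c, hη, hc, hlow⟩ := exists_le_norm_eval_exp hh0 hd
  -- Chosen so that the half-opening πε/2 is η, the width on which |h| is bounded below.
  set ε := 2 * η / Real.pi with hεdef
  have hπ := Real.pi_pos
  have hε : 0 < ε := by positivity
  have hεη : Real.pi * ε / 2 = η := by rw [hεdef]; field_simp
  have hlow' : ∀ w ∈ unboundedSector d ε, c ≤ ‖P.eval (exp w)‖ := fun w hw =>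
    hlow w (by rw [← hεη]; exact hw)
  have hne : ∀ w ∈ unboundedSector d ε, P.eval (exp w) ≠ 0 := fun w hw =>
    norm_pos_iff.1 (hc.trans_le (hlow' w hw))
  set Φ : ℂ → ℂ := fun w => borelSum q g w / P.eval (exp w) with hΦ
  obtain ⟨C, κ, hC, hκ, hbd⟩ := hg.exists_norm_borelSum_le hq
  have hgrow : HasGrowth q d ε (C / c) κ Φ := by
    refine ⟨?_, by positivity, hκ, fun w hw => ?_⟩
    · refine (hg.differentiable_borelSum hq).differentiableOn.div
        (Differentiable.differentiableOn ?_) hne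
      exact P.differentiable.comp Complex.differentiable_exp
    · rw [hΦ]
      simp only
      rw [norm_div, div_mul_eq_mul_div]
      have := growth_pos q κ w.re
      exact div_le_div₀ (by positivity) (hbd w) hc (hlow' w hw)
  have hbor := h.exists_norm_borelCoeff_le hq
  have hcont : IsBorelContinuation q f d ε Φ := by
    refine ⟨hgrow.differentiableOn, ?_, hgrow.exists_norm_le hq⟩
    obtain ⟨C', A, hC', hA, hb⟩ := hbor
    refine ⟨(2 * A)⁻¹, by positivity, fun w hw => ?_⟩
    have hsum : Summable fun p : ℕ => borelCoeff q f p * exp w ^ p := by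
      refine Summable.of_norm_bounded
        ((summable_geometric_of_lt_one (r := (1 / 2 : ℝ)) (by norm_num) (by norm_num)).mul_left C')
        fun p => ?_
      have hw2 : Real.exp w.re < (2 * A)⁻¹ := hw.2
      rw [norm_mul, norm_pow, Complex.norm_exp]
      calc _ ≤ C' * A ^ p * (2 * A)⁻¹ ^ p := by gcongr; exact hb p
        _ = C' * (1 / 2) ^ p := by
          rw [mul_assoc, ← mul_pow]; congr 2; field_simp
    have h1 := hsum.hasSum
    simp only [← coeff_formalBorel] at h1
    have h2 := hasSum_coeff_polynomial_mul h1 P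
    rw [← formalBorel_formalOp hq, ← hgdef] at h2
    simp only [coeff_formalBorel] at h1 h2
    have h3 := h2.unique (hg.hasSum_borelSum hq w)
    have h4 : Φ w = ∑' p : ℕ, borelCoeff q f p * exp w ^ p := by
      rw [hΦ]
      simp only
      rw [← h3, mul_div_cancel_left₀ _ (hne w hw.1)]
    rw [h4]
    exact hsum.hasSum
  refine ⟨⟨isQGevrey_of_borelCoeff hq hbor, ε, hε, Φ, hcont⟩, ?_⟩
  obtain ⟨θ, F, hθ, hQ, hFd⟩ := hgrow.exists_isQSum hq hε hcont
  set R := Real.exp (-(Real.log q * (κ + 1))) with hR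
  refine ⟨θ, R, F, hθ, Real.exp_pos _, hQ, ?_⟩
  obtain ⟨ρ₀, hρ₀, hgρ₀⟩ := hg
  set ρ := min ρ₀ (R / q ^ P.natDegree) with hρ
  have hρpos : 0 < ρ := lt_min hρ₀ (by positivity)
  have hρR : q ^ P.natDegree * ρ ≤ R := by
    calc _ ≤ q ^ P.natDegree * (R / q ^ P.natDegree) := by gcongr; exact min_le_right _ _
      _ = R := by field_simp
  have hgρ : ConvergesAt g ρ := hgρ₀.mono hρpos.le (min_le_left _ _)
  refine ⟨ρ, hρpos, hρR, hgρ, hasQGevreyExpansion_zero hq ?_⟩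
  have hmem : ∀ w ∈ sector d θ ρ, ∀ k ≤ P.natDegree, w + k * Real.log q ∈ sector d θ R :=
    fun w hw k hk => add_nat_mul_log_mem_sector hq hk hρR hw
  -- The inversion of the Borel transform is available only on the ray arg z = d; the identity
  -- theorem carries the equation to the whole sector.
  refine eq_zero_on_sector (by linarith) hρpos ?_ ?_
  · refine DifferentiableOn.sub ?_ (differentiableOn_tsum_exp hgρ)
    rw [show functionOp q P F = _ from funext fun w => functionOp_apply P F w]
    refine DifferentiableOn.fun_sum fun k hk => ?_
    refine DifferentiableOn.const_mul (DifferentiableOn.mul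
      (Differentiable.differentiableOn (by fun_prop)) ?_) _
    exact hQ.1.comp (Differentiable.differentiableOn (by fun_prop)) fun w hw =>
      hmem w hw k (Nat.lt_succ_iff.1 (Finset.mem_range.1 hk))
  · intro w hw hwd
    have hdw : ∀ u ∈ sector d θ R, u.im = d → F u = 1 / (Real.log q : ℂ) * logLaplace q Φ d u :=
      fun u hu hud => hFd u hu (by rw [hud, sub_self, abs_zero]; exact hπ)
    have h1 := (hgrow.functionOp_eq (F := F) hq hε P (w := w)
      (by rw [hwd, sub_self, abs_zero]; exact hπ) (by
        have := (sector_iff_re_lt.1 (hmem w hw _ le_rfl)).2.le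
        simpa using this)
      (fun k hk => hdw _ (hmem w hw k hk) (by simpa using hwd))).2
    have h2 : ∀ s : ℝ, P.eval (exp (s + d * I)) * Φ (s + d * I) = borelSum q g (s + d * I) := by
      intro s
      rw [hΦ]
      exact mul_div_cancel₀ _ (hne _ (by simpa [unboundedSector] using mul_pos hπ hε))
    simp only [h2] at h1
    have h3 := logLaplace_borelSum hq g d hwd (hgρ.mono (Real.exp_pos _).le (le_of_lt hw.2))
    rw [logLaplace] at h3
    rw [h1, h3, ← mul_assoc, one_div, inv_mul_cancel₀ (by exact_mod_cast hL.ne'), one_mul, sub_self]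

/-- A quasi-solution given by a sum forces the formal equation. -/
lemma SummableToQuasiSolution.exists_formalSolution (hq : 1 < q) {f : ℂ⟦X⟧} {h : Polynomial ℂ}
    (hne : h ≠ 0) (hs : SummableToQuasiSolution q f h) :
    ∃ (P : Polynomial ℂ) (g : ℂ⟦X⟧), P.eval 0 ≠ 0 ∧ IsConvergent g ∧
      IsTheFormalSolution q P g f := by
  have hL := log_pos_of_one_lt hq
  have hπ := Real.pi_pos
  have hq0 : 0 < q := by linarith
  obtain ⟨P, g, hP, hg, hs⟩ := hs
  refine ⟨P, g, hP, hg, (isTheFormalSolution_iff hq (ne_zero_of_eval_zero hP)).2 ?_⟩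
  obtain ⟨d, hd⟩ := exists_not_isRootArgument hne
  obtain ⟨-, θ, R, F, hθ, hR, ⟨-, ε, hε, Φ, hΦ, hF⟩, ρ, hρ, hρR, hgρ, -, hasym⟩ := hs d hd
  obtain ⟨C₁, κ₁, hgrow⟩ := hΦ.exists_hasGrowth hq hε
  obtain ⟨C₂, κ₂, hC₂, hκ₂, hbd₂⟩ := hg.exists_norm_borelSum_le hq
  obtain ⟨C₃, hC₃, hbd₃⟩ := exists_norm_polynomial_mul_le hgrow.norm_le hgrow.pos P
  have hκ₁ := hgrow.nonneg
  have hdε : ∀ s : ℝ, (s + d * I : ℂ) ∈ unboundedSector d ε := fun s => by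
    simpa [unboundedSector] using mul_pos hπ hε
  -- The defect of the equation on the Borel side; its Taylor coefficients at 0 are the c p below.
  set A : ℝ → ℂ := fun s => P.eval (exp (s + d * I)) * Φ (s + d * I) - borelSum q g (s + d * I)
    with hA
  set c : ℕ → ℂ := fun p => borelCoeff q (formalOp q P f) p - borelCoeff q g p with hc
  set κ := κ₁ + P.natDegree + κ₂ with hκ
  have hΦc : Continuous fun s : ℝ => Φ (s + d * I) := continuous_iff_continuousAt.2 fun s =>
    ContinuousAt.comp' (f := fun s : ℝ => (s + d * I : ℂ))
      (hgrow.differentiableOn.differentiableAt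
        ((isOpen_unboundedSector d ε).mem_nhds (hdε s))).continuousAt (by fun_prop)
  have hAc : Continuous A := by
    refine Continuous.sub (Continuous.mul ?_ hΦc)
      ((hg.differentiable_borelSum hq).continuous.comp (by fun_prop))
    exact P.continuous.comp (by fun_prop)
  have hAg : ∀ s, ‖A s‖ ≤ (C₃ + C₂) * growth q κ s := by
    intro s
    have h1 := hbd₃ _ (hdε s)
    have h2 := hbd₂ (s + d * I)
    have hre : (s + d * I : ℂ).re = s := by simp
    rw [hre] at h1 h2
    have h3 : growth q (κ₁ + P.natDegree) s ≤ growth q κ s :=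
      growth_mono_exponent (by linarith) s
    have h4 : growth q κ₂ s ≤ growth q κ s := by
      refine growth_mono_exponent ?_ s
      have : (0 : ℝ) ≤ P.natDegree := Nat.cast_nonneg _
      linarith
    calc ‖A s‖ ≤ C₃ * growth q (κ₁ + P.natDegree) s + C₂ * growth q κ₂ s :=
          (norm_sub_le _ _).trans (add_le_add h1 h2)
      _ ≤ C₃ * growth q κ s + C₂ * growth q κ s := by gcongr
      _ = _ := by ring
  obtain ⟨ρ₁, hρ₁, hsum⟩ := hΦ.2.1
  have hAsum : ∀ s ≤ Real.log (ρ₁ / 2), HasSum (fun p : ℕ => c p * exp (s + d * I) ^ p) (A s) := by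
    intro s hs'
    have h0 : (s + d * I : ℂ) ∈ sector d ε ρ₁ := by
      refine ⟨hdε s, ?_⟩
      have : Real.exp s ≤ ρ₁ / 2 := by
        rw [← Real.exp_log (by positivity : 0 < ρ₁ / 2)]; exact Real.exp_le_exp.2 hs'
      have hre : (s + d * I : ℂ).re = s := by simp
      rw [hre]; linarith
    have h1 := hsum _ h0
    simp only [← coeff_formalBorel] at h1
    have h2 := hasSum_coeff_polynomial_mul h1 P
    rw [← formalBorel_formalOp hq] at h2
    simp only [coeff_formalBorel] at h2
    simpa only [hc, sub_mul] using h2.sub (hg.hasSum_borelSum hq (s + d * I))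
  have hEq : ∀ᶠ x : ℝ in atBot, (x + d * I : ℂ) ∈ sector d 1 (ρ / 2) ∧
      functionOp q P F (x + d * I) - ∑' p : ℕ, coeff p g * exp (x + d * I) ^ p =
        1 / (Real.log q : ℂ) * ∫ s : ℝ, A s / logTheta q ((s - x : ℝ) : ℂ) := by
    filter_upwards [eventually_lt_atBot (Real.log (ρ / 2)),
      eventually_le_atBot (-(Real.log q * (κ₁ + 1)) - P.natDegree * Real.log q),
      eventually_le_atBot (-(Real.log q * (κ₂ + 1)))] with x hx₁ hx₂ hx₃
    set w : ℂ := x + d * I with hw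
    have hre : w.re = x := by simp [hw]
    have him : w.im = d := by simp [hw]
    have hxρ : Real.exp x < ρ / 2 := by
      rw [← Real.exp_log (by positivity : 0 < ρ / 2)]; exact Real.exp_lt_exp.2 hx₁
    have hw1 : w ∈ sector d θ ρ :=
      ⟨by rw [him, sub_self, abs_zero]; positivity, by rw [hre]; linarith⟩
    refine ⟨⟨by rw [him, sub_self, abs_zero]; positivity, by rwa [hre]⟩, ?_⟩
    obtain ⟨hi₁, h1⟩ := hgrow.functionOp_eq (F := F) hq hε P (w := w)
      (by rw [him, sub_self, abs_zero]; exact hπ) (by rw [hre]; linarith)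
      (fun k hk => by
        rw [← qLaplace_eq]
        refine (hF _ (add_nat_mul_log_mem_sector hq hk hρR hw1) ?_).2
        simpa [him] using hπ)
    have hgrow₂ : HasGrowth q d ε C₂ κ₂ (borelSum q g) :=
      ⟨(hg.differentiable_borelSum hq).differentiableOn, hC₂, hκ₂, fun u _ => hbd₂ u⟩
    have hi₂ := hgrow₂.integrable hq (e := d) (w := w) (by rw [sub_self, abs_zero]; positivity)
      (by rw [him, sub_self, abs_zero]; exact hπ) (by rw [hre]; exact hx₃)
    have h3 := logLaplace_borelSum hq g d him (hgρ.mono (Real.exp_pos _).le (le_of_lt hw1.2))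
    rw [logLaplace] at h3
    have h4 : ∑' p : ℕ, coeff p g * exp w ^ p = 1 / (Real.log q : ℂ) *
        ∫ s : ℝ, borelSum q g (s + d * I) / logTheta q (s + d * I - w) := by
      rw [h3, ← mul_assoc, one_div, inv_mul_cancel₀ (by exact_mod_cast hL.ne'), one_mul]
    rw [h1, h4, ← mul_sub, ← integral_sub hi₁ hi₂]
    congr 1
    refine integral_congr_ae (Eventually.of_forall fun s => ?_)
    simp only [hA]
    rw [logTheta_ray d s him, hre, sub_div]
  -- Any proper subsector containing the end of the ray will do; opening π and radius ρ/2 fit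
  -- because θ > 2.
  have hcl : closure (sector d 1 (ρ / 2)) ⊆ sector d θ ρ := by
    have hclosed : IsClosed {w : ℂ | |w.im - d| ≤ Real.pi * 1 / 2 ∧ Real.exp w.re ≤ ρ / 2} :=
      (isClosed_le (f := fun w : ℂ => |w.im - d|) (by fun_prop) continuous_const).inter
        (isClosed_le (f := fun w : ℂ => Real.exp w.re) (by fun_prop) continuous_const)
    have hsub : sector d 1 (ρ / 2) ⊆
        {w : ℂ | |w.im - d| ≤ Real.pi * 1 / 2 ∧ Real.exp w.re ≤ ρ / 2} := by
      intro w hw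
      exact ⟨hw.1.le, hw.2.le⟩
    intro w hw'
    have hw := closure_minimal hsub hclosed hw'
    refine ⟨?_, ?_⟩
    · refine lt_of_le_of_lt hw.1 ?_
      have : Real.pi * 1 < Real.pi * θ := by gcongr; linarith
      linarith
    · exact lt_of_le_of_lt hw.2 (by linarith)
  obtain ⟨D, B, hD, hB, hbound⟩ := hasym d 1 (ρ / 2) one_pos (by positivity) hcl
  have hczero : ∀ N, c N = 0 := by
    intro N
    induction N using Nat.strong_induction_on with
    | _ N ih =>
      have hlim := tendsto_laplace_leading hq hAc (by positivity)
        (by positivity : 0 ≤ κ) hAg hAsum ih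
      -- Flatness at order N + 1 leaves one spare factor |z| after division by z^N, so the limit is
      -- 0. It is also c N times a nonzero moment.
      have hlim0 : Tendsto (fun x : ℝ => (exp (x + d * I) ^ N)⁻¹ *
          ∫ s : ℝ, A s / logTheta q ((s - x : ℝ) : ℂ)) atBot (𝓝 0) := by
        have hz : Tendsto (fun x : ℝ => Real.log q * (D * B ^ (N + 1) *
            q ^ ((N + 1) * (N + 1 - 1) / 2)) * Real.exp x) atBot (𝓝 0) := by
          simpa using Real.tendsto_exp_atBot.const_mul
            (Real.log q * (D * B ^ (N + 1) * q ^ ((N + 1) * (N + 1 - 1) / 2)))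
        refine squeeze_zero_norm' ?_ hz
        filter_upwards [hEq] with x hx
        have h1 := hbound (N + 1) _ hx.1
        simp only [map_zero, zero_mul, Finset.sum_const_zero, sub_zero] at h1
        rw [hx.2, norm_mul] at h1
        have hn : ‖exp (x + d * I)‖ = Real.exp x := by rw [Complex.norm_exp]; simp
        have hn1 : ‖(1 / (Real.log q : ℂ))‖ = (Real.log q)⁻¹ := by
          rw [one_div, norm_inv, Complex.norm_real, Real.norm_of_nonneg hL.le]
        rw [hn1, hn, inv_mul_le_iff₀ hL] at h1
        rw [norm_mul, norm_inv, norm_pow, hn, inv_mul_le_iff₀ (by positivity)]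
        refine h1.trans (le_of_eq ?_)
        rw [pow_succ (Real.exp x)]; ring
      have h0 := tendsto_nhds_unique hlim hlim0
      refine (mul_eq_zero.1 h0).resolve_right ?_
      exact_mod_cast (by positivity : Real.log q * q ^ (N * (N - 1) / 2) ≠ 0)
  refine formalBorel_injective hq ?_
  ext n
  rw [coeff_formalBorel, coeff_formalBorel]
  exact sub_eq_zero.1 (hczero n)

end QGevrey

end

theorem mainTheorem6 (q : ℝ) (hq : 1 < q) (f : PowerSeries ℂ)
    (hf : PowerSeries.constantCoeff f = 0) :
    List.TFAE [
      ∃ (P : Polynomial ℂ) (g : PowerSeries ℂ), P.eval 0 ≠ 0 ∧ QGevrey.IsConvergent g ∧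
        QGevrey.IsTheFormalSolution q P g f,
      ∃ (r : ℕ) (a : ℕ → ℂ), 1 ≤ r ∧ QGevrey.RecurrenceEstimate q f r a,
      ∃ (r : ℕ) (a : ℕ → ℂ), 1 ≤ r ∧
        QGevrey.SummableToQuasiSolution q f (QGevrey.hPoly r a)] ∧
    ∀ (r : ℕ) (a : ℕ → ℂ), 1 ≤ r → QGevrey.RecurrenceEstimate q f r a →
      QGevrey.SummableToQuasiSolution q f (QGevrey.hPoly r a) := by
  refine ⟨?_, fun r a _ h => h.summableToQuasiSolution hq⟩
  tfae_have 1 ↔ 2 := QGevrey.exists_recurrenceEstimate_iff hq f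
  tfae_have 2 → 3 := by
    rintro ⟨r, a, hr, h⟩
    exact ⟨r, a, hr, h.summableToQuasiSolution hq⟩
  tfae_have 3 → 1 := by
    rintro ⟨r, a, -, h⟩
    exact h.exists_formalSolution hq (QGevrey.hPoly_ne_zero r a)
  tfae_finish
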